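/- **Theorem.** Let $k$ be a field and let $(\mathcal C,\mathbb E)$ be a $0$-Auslander extriangulated $k$-category: it has enough projectives, every functor $\mathbb E(x,-)$ is right exact (sends conflations $a\to b\to c$ to exact sequences $\mathbb E(x,a)\to\mathbb E(x,b)\to\mathbb E(x,c)\to 0$), and every projective object is the domain of an inflation with projective-injective codomain. Let $\mathcal R\subseteq\mathcal C$ be a rigid subcategory, i.e. a full additive subcategory, closed under isomorphisms and direct summands, with $\mathbb E^i(r,r')=0$ for all $r,r'\in\mathcal R$ and $i\ge 1$. *Notation.* - $\mathcal R^{\perp}$ (resp. ${}^{\perp}\mathcal R$) is the full subcategory of all $y$ with $\mathbb E^i(r,y)=0$ (resp. $\mathbb E^i(y,r)=0$) for all $r\in\mathcal R$, $i\ge1$. - $\mathcal R^{\vee}$ (resp. $\mathcal R^{\wedge}$) is the smallest full subcategory containing $\mathcal R$ and closed under extensions, cocones (resp. cones) and direct summands. - $\mathcal A$ is the smallest additive subcategory containing $\mathcal R$ and all projective-injective objects. - A right $\mathcal X$-approximation of $y$ is a morphism $a\to y$ with $a\in\mathcal X$ through which every morphism from an object of $\mathcal X$ to $y$ factors; left approximations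 are dual. - $\mathcal R$ *admits a maximal Bongartz completion* if every injective object $y$ admits a deflation $r'\to y$ that is a right $\mathcal A$-approximation. It *admits a minimal Bongartz completion* if every projective object $y$ admits an inflation $y\to r'$ that is a left $\mathcal A$-approximation. It *admits Bongartz completions* if it admits both. - For additive subcategories $\mathcal U,\mathcal V$ closed under isomorphisms and direct summands, such that every morphism $u\to v$ with $u\in\mathcal U$, $v\in\mathcal V$ factors through an object of $\mathcal U\cap\mathcal V$, the pair $(\mathcal U,\mathcal V)$ is a *left cotorsion pair* if every $x\in\mathcal C$ admits a conflation $x\to x_{\mathcal V}\to x_{\mathcal U}$ in which $x\to x_{\mathcal V}$ is a left $\mathcal V$-approximation and $x_{\mathcal U}\in\mathcal U$. It is a *right cotorsion pair* if every $x\in\mathcal C$ admits a conflation $x^{\mathcal V}\to x^{\mathcal U}\to x$ in which $x^{\mathcal U}\to x$ is a right $\mathcal U$-approximation and $x^{\mathcal V}\in\mathcal V$. - $((\mathcal U,\mathcal V),(\mathcal X,\mathcal Y))$ is a *generalized concentric twin cotorsion pair* (gCTCP) if $(\mathcal U,\mathcal V)$ is a left cotorsion pair, $(\mathcal X,\mathcal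 Y)$ is a right cotorsion pair, $\mathcal U\subseteq\mathcal X$, $\mathcal Y\subseteq\mathcal V$ and $\mathcal U\cap\mathcal V=\mathcal X\cap\mathcal Y$. Then: 1. $\mathcal R$ admits a maximal Bongartz completion if and only if $(\mathcal R,\mathcal R^{\perp})$ is a left cotorsion pair. 2. $\mathcal R$ admits a minimal Bongartz completion if and only if $({}^{\perp}\mathcal R,\mathcal R)$ is a right cotorsion pair. 3. $\mathcal R$ admits Bongartz completions if and only if $((\mathcal R,\mathcal R^{\perp}),({}^{\perp}\mathcal R,\mathcal R))$ is a gCTCP. In particular, if $\mathcal R$ admits Bongartz completions, then condition (gCP) holds for $\mathcal R$: the tuple $((\mathcal R^{\vee},\mathcal R^{\perp}),({}^{\perp}\mathcal R,\mathcal R^{\wedge}))$ is a gCTCP. -/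

import Mathlib

open CategoryTheory CategoryTheory.Limits Opposite
open scoped TensorProduct DirectSum

universe t w v u

/-! # Full subcategories

Full subcategories of `C` are represented by predicates `ObjectProperty C` on objects. -/

section Subcategories

variable {C : Type u} [Category.{v} C] [Preadditive C] [HasZeroObject C] [HasBinaryBiproducts C]

/-- A full additive subcategory, closed under isomorphism: it contains a zero object and is closed
under binary biproducts. -/
structure IsAdditiveSubcategory (P : ObjectProperty C) : Prop where
  iso_closed : ∀ {x y : C}, Nonempty (x ≅ y) → P x → P y
  zero_mem : ∃ z : C, IsZero z ∧ P z
  biprod_mem : ∀ {x y : C}, P x → P y → P (x ⊞ y)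

/-- Closure under direct summands: if `z ≅ x ⊞ y` and `P z`, then `P x`. -/
def IsClosedUnderSummands (P : ObjectProperty C) : Prop :=
  ∀ {x y z : C}, Nonempty (z ≅ x ⊞ y) → P z → P x

/-- The smallest additive subcategory containing `P`. -/
def additiveClosure (P : ObjectProperty C) : ObjectProperty C := fun x =>
  ∀ Q : ObjectProperty C, IsAdditiveSubcategory Q → P ≤ Q → Q x

/-- A right `P`-approximation of `y`: a morphism `p : a ⟶ y` with `a` in `P`, through which every
morphism from an object of `P` to `y` factors. -/
def IsRightApproximation (P : ObjectProperty C) {a y : C} (p : a ⟶ y) : Prop :=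
  P a ∧ ∀ (x : C), P x → ∀ f : x ⟶ y, ∃ g : x ⟶ a, g ≫ p = f

/-- A left `P`-approximation of `x`: a morphism `i : x ⟶ a` with `a` in `P`, through which every
morphism from `x` to an object of `P` factors. -/
def IsLeftApproximation (P : ObjectProperty C) {x a : C} (i : x ⟶ a) : Prop :=
  P a ∧ ∀ (y : C), P y → ∀ f : x ⟶ y, ∃ g : a ⟶ y, i ≫ g = f

end Subcategories

/-! # Extriangulated categories -/

section Bifunctor

variable {k : Type t} [Field k] {C : Type u} [Category.{v} C]

/-- The `k`-module `𝔼(c, a)` of extensions of `c` by `a`. -/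
abbrev ExtModule (E : Cᵒᵖ ⥤ C ⥤ ModuleCat.{w} k) (c a : C) : Type w :=
  (E.obj (op c)).obj a

/-- The map `f_* = 𝔼(c, f) : 𝔼(c, a) → 𝔼(c, a')` for `f : a ⟶ a'`. -/
def extPush (E : Cᵒᵖ ⥤ C ⥤ ModuleCat.{w} k) {c a a' : C} (f : a ⟶ a') :
    ExtModule E c a →ₗ[k] ExtModule E c a' :=
  ((E.obj (op c)).map f).hom

/-- The map `g^* = 𝔼(g, a) : 𝔼(c, a) → 𝔼(c', a)` for `g : c' ⟶ c`. -/
def extPull (E : Cᵒᵖ ⥤ C ⥤ ModuleCat.{w} k) {c c' a : C} (g : c' ⟶ c) :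
    ExtModule E c a →ₗ[k] ExtModule E c' a :=
  ((E.map g.op).app a).hom

/-! ## Higher extensions

The higher extension bifunctors are the coend powers `𝔼ⁿ⁺¹(c, a) = ∫ˣ 𝔼ⁿ(x, a) ⊗ 𝔼(c, x)`.
The coend is written out below as a quotient of a direct sum. The object `a` is kept fixed and
only the contravariant functoriality in `c`, which the recursion needs, is recorded. -/

open Classical in
/-- The relations `f^* ξ ⊗ η = ξ ⊗ f_* η` defining the coend `∫ˣ F(x) ⊗ 𝔼(c, x)`. -/
def coendRelations (E : Cᵒᵖ ⥤ C ⥤ ModuleCat.{w} k) (F : Cᵒᵖ ⥤ ModuleCat.{max u w} k)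
    (c : C) : Submodule k (⨁ x : C, (F.obj (op x) : Type (max u w)) ⊗[k] ExtModule E c x) :=
  Submodule.span k
    {z | ∃ (x x' : C) (f : x ⟶ x') (ξ : F.obj (op x')) (η : ExtModule E c x),
      z = DirectSum.lof k C (fun x : C => (F.obj (op x) : Type (max u w)) ⊗[k] ExtModule E c x) x
            ((F.map f.op).hom ξ ⊗ₜ[k] η)
          - DirectSum.lof k C (fun x : C => (F.obj (op x) : Type (max u w)) ⊗[k] ExtModule E c x) x'
            (ξ ⊗ₜ[k] extPush E f η)}

/-- The action of `g : c' ⟶ c` on the direct sums whose quotients are the coends. -/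
def coendPre (E : Cᵒᵖ ⥤ C ⥤ ModuleCat.{w} k) (F : Cᵒᵖ ⥤ ModuleCat.{max u w} k) {c c' : C}
    (g : c' ⟶ c) :
    (⨁ x : C, (F.obj (op x) : Type (max u w)) ⊗[k] ExtModule E c x) →ₗ[k]
      (⨁ x : C, (F.obj (op x) : Type (max u w)) ⊗[k] ExtModule E c' x) :=
  DirectSum.lmap (fun x : C => TensorProduct.map LinearMap.id (extPull E (a := x) g))

lemma extPull_extPush (E : Cᵒᵖ ⥤ C ⥤ ModuleCat.{w} k) {c c' a a' : C} (g : c' ⟶ c) (f : a ⟶ a')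
    (η : ExtModule E c a) : extPull E g (extPush E f η) = extPush E f (extPull E g η) := by
  have h := (E.map g.op).naturality f
  exact congrArg (fun φ => φ.hom η) h

lemma coendRelations_le (E : Cᵒᵖ ⥤ C ⥤ ModuleCat.{w} k) (F : Cᵒᵖ ⥤ ModuleCat.{max u w} k)
    {c c' : C} (g : c' ⟶ c) :
    coendRelations E F c ≤ (coendRelations E F c').comap (coendPre E F g) := by
  classical
  refine Submodule.span_le.2 ?_
  rintro _ ⟨x, x', f, ξ, η, rfl⟩
  refine Submodule.subset_span ⟨x, x', f, ξ, extPull E g η, ?_⟩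
  simp only [coendPre, map_sub, ← extPull_extPush]
  congr 1
  · exact DirectSum.lmap_lof _ _ _
  · exact DirectSum.lmap_lof _ _ _

lemma coendPre_id (E : Cᵒᵖ ⥤ C ⥤ ModuleCat.{w} k) (F : Cᵒᵖ ⥤ ModuleCat.{max u w} k) (c : C) :
    coendPre E F (𝟙 c) = LinearMap.id := by
  have h : ∀ x : C, extPull E (a := x) (𝟙 c) = LinearMap.id := fun x => by
    simp [extPull]
  simp [coendPre, h]

lemma coendPre_comp (E : Cᵒᵖ ⥤ C ⥤ ModuleCat.{w} k) (F : Cᵒᵖ ⥤ ModuleCat.{max u w} k)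
    {c c' c'' : C} (g : c' ⟶ c) (g' : c'' ⟶ c') :
    coendPre E F (g' ≫ g) = (coendPre E F g').comp (coendPre E F g) := by
  have h : ∀ x : C, extPull E (a := x) (g' ≫ g) = (extPull E g').comp (extPull E g) := fun x => by
    simp [extPull]
  refine LinearMap.ext fun z => DFinsupp.ext fun x => ?_
  have h' : TensorProduct.map (LinearMap.id : F.obj (op x) →ₗ[k] F.obj (op x))
      (extPull E (a := x) (g' ≫ g)) =
      (TensorProduct.map LinearMap.id (extPull E g')).comp
        (TensorProduct.map LinearMap.id (extPull E g)) := by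
    rw [h, ← TensorProduct.map_comp, LinearMap.id_comp]
  exact congrArg (fun φ => φ (z x)) h'

/-- The functor `c ↦ ∫ˣ F(x) ⊗ 𝔼(c, x)`. -/
def coendTensor (E : Cᵒᵖ ⥤ C ⥤ ModuleCat.{w} k) (F : Cᵒᵖ ⥤ ModuleCat.{max u w} k) :
    Cᵒᵖ ⥤ ModuleCat.{max u w} k where
  obj c := ModuleCat.of k
    ((⨁ x : C, (F.obj (op x) : Type (max u w)) ⊗[k] ExtModule E c.unop x) ⧸
      coendRelations E F c.unop)
  map g := ModuleCat.ofHom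
    (Submodule.mapQ _ _ (coendPre E F g.unop) (coendRelations_le E F g.unop))
  map_id c := by
    refine ModuleCat.hom_ext (LinearMap.ext fun y => ?_)
    obtain ⟨y, rfl⟩ := Submodule.Quotient.mk_surjective _ y
    simp [coendPre_id]
  map_comp g g' := by
    refine ModuleCat.hom_ext (LinearMap.ext fun y => ?_)
    obtain ⟨y, rfl⟩ := Submodule.Quotient.mk_surjective _ y
    simp [coendPre_comp]

/-- `higherExt E a n` is the functor `𝔼ⁿ⁺¹(-, a)`, so that `higherExt E a 0` is `𝔼(-, a)` (moved to
a larger universe). -/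
def higherExt (E : Cᵒᵖ ⥤ C ⥤ ModuleCat.{w} k) (a : C) : ℕ → (Cᵒᵖ ⥤ ModuleCat.{max u w} k)
  | 0 => E.flip.obj a ⋙ ModuleCat.uliftFunctor.{u, w} k
  | n + 1 => coendTensor E (higherExt E a n)

/-- `𝔼ⁱ(c, a) = 0` for all `i ≥ 1`. -/
def HigherExtVanish (E : Cᵒᵖ ⥤ C ⥤ ModuleCat.{w} k) (c a : C) : Prop :=
  ∀ (n : ℕ) (ξ : (higherExt E a n).obj (op c)), ξ = 0

end Bifunctor

/-- An extriangulation (in the sense of Nakaoka and Palu) on an additive `k`-category `C`: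
a `k`-bilinear bifunctor `E`, an additive realization of it, and the axioms (ET3), (ET4) and their
duals. The realization `𝔰` is encoded by the predicate `Realizes x y δ`, which says that the
sequence `a ⟶ b ⟶ c` belongs to the equivalence class `𝔰(δ)`, for `δ ∈ 𝔼(c, a)`. -/
structure Extriangulation (k : Type t) [Field k] (C : Type u) [Category.{v} C] [Preadditive C]
    [Linear k C] [HasZeroObject C] [HasBinaryBiproducts C] where
  /-- The bifunctor `𝔼`. -/
  E : Cᵒᵖ ⥤ C ⥤ ModuleCat.{w} k
  push_add : ∀ {c a a' : C} (f g : a ⟶ a') (δ : ExtModule E c a),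
    extPush E (f + g) δ = extPush E f δ + extPush E g δ
  push_smul : ∀ {c a a' : C} (r : k) (f : a ⟶ a') (δ : ExtModule E c a),
    extPush E (r • f) δ = r • extPush E f δ
  pull_add : ∀ {c c' a : C} (f g : c' ⟶ c) (δ : ExtModule E c a),
    extPull E (f + g) δ = extPull E f δ + extPull E g δ
  pull_smul : ∀ {c c' a : C} (r : k) (f : c' ⟶ c) (δ : ExtModule E c a),
    extPull E (r • f) δ = r • extPull E f δ
  /-- `a ⟶ b ⟶ c` realizes `δ`. -/
  Realizes : ∀ {a b c : C}, (a ⟶ b) → (b ⟶ c) → ExtModule E c a → Prop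
  /-- Every extension is realized. -/
  exists_realizes : ∀ {a c : C} (δ : ExtModule E c a),
    ∃ (b : C) (x : a ⟶ b) (y : b ⟶ c), Realizes x y δ
  /-- Two sequences realizing the same extension are equivalent. -/
  realizes_unique : ∀ {a b b' c : C} {x : a ⟶ b} {y : b ⟶ c} {x' : a ⟶ b'} {y' : b' ⟶ c}
    {δ : ExtModule E c a}, Realizes x y δ → Realizes x' y' δ →
    ∃ e : b ≅ b', x ≫ e.hom = x' ∧ e.hom ≫ y' = y
  /-- A sequence equivalent to one that realizes `δ` realizes `δ`. -/
  realizes_of_iso : ∀ {a b b' c : C} {x : a ⟶ b} {y : b ⟶ c} {x' : a ⟶ b'} {y' : b' ⟶ c}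
    {δ : ExtModule E c a}, Realizes x y δ → ∀ e : b ≅ b', x ≫ e.hom = x' → e.hom ≫ y' = y →
    Realizes x' y' δ
  /-- A morphism of extensions is realized by a morphism of sequences. -/
  realizes_lift : ∀ {a b c a' b' c' : C} {x : a ⟶ b} {y : b ⟶ c} {δ : ExtModule E c a}
    {x' : a' ⟶ b'} {y' : b' ⟶ c'} {δ' : ExtModule E c' a'},
    Realizes x y δ → Realizes x' y' δ' → ∀ (f : a ⟶ a') (h : c ⟶ c'),
    extPush E f δ = extPull E h δ' → ∃ g : b ⟶ b', x ≫ g = f ≫ x' ∧ y ≫ h = g ≫ y'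
  /-- The zero extension is realized by the split sequence. -/
  realizes_zero : ∀ (a c : C),
    Realizes (biprod.inl : a ⟶ a ⊞ c) (biprod.snd : a ⊞ c ⟶ c) (0 : ExtModule E c a)
  /-- The realization of a direct sum of extensions is the direct sum of the realizations. -/
  realizes_biprod : ∀ {a b c a' b' c' : C} {x : a ⟶ b} {y : b ⟶ c} {δ : ExtModule E c a}
    {x' : a' ⟶ b'} {y' : b' ⟶ c'} {δ' : ExtModule E c' a'},
    Realizes x y δ → Realizes x' y' δ' →
    Realizes (biprod.map x x') (biprod.map y y')
      (extPush E (biprod.inl : a ⟶ a ⊞ a') (extPull E (biprod.fst : c ⊞ c' ⟶ c) δ) +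
        extPush E (biprod.inr : a' ⟶ a ⊞ a') (extPull E (biprod.snd : c ⊞ c' ⟶ c') δ'))
  /-- (ET3) -/
  et3 : ∀ {a b c a' b' c' : C} {x : a ⟶ b} {y : b ⟶ c} {δ : ExtModule E c a}
    {x' : a' ⟶ b'} {y' : b' ⟶ c'} {δ' : ExtModule E c' a'},
    Realizes x y δ → Realizes x' y' δ' → ∀ (f : a ⟶ a') (g : b ⟶ b'), x ≫ g = f ≫ x' →
    ∃ h : c ⟶ c', y ≫ h = g ≫ y' ∧ extPush E f δ = extPull E h δ'
  /-- (ET3)ᵒᵖ -/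
  et3_op : ∀ {a b c a' b' c' : C} {x : a ⟶ b} {y : b ⟶ c} {δ : ExtModule E c a}
    {x' : a' ⟶ b'} {y' : b' ⟶ c'} {δ' : ExtModule E c' a'},
    Realizes x y δ → Realizes x' y' δ' → ∀ (g : b ⟶ b') (h : c ⟶ c'), y ≫ h = g ≫ y' →
    ∃ f : a ⟶ a', x ≫ g = f ≫ x' ∧ extPush E f δ = extPull E h δ'
  /-- (ET4): for `a -f→ b -f'→ d` realizing `δ` and `b -g→ c -g'→ q` realizing `δ'`. -/
  et4 : ∀ {a b c d q : C} {f : a ⟶ b} {f' : b ⟶ d} {δ : ExtModule E d a}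
    {g : b ⟶ c} {g' : c ⟶ q} {δ' : ExtModule E q b},
    Realizes f f' δ → Realizes g g' δ' →
    ∃ (e : C) (h' : c ⟶ e) (m : d ⟶ e) (n : e ⟶ q) (δ'' : ExtModule E e a),
      Realizes (f ≫ g) h' δ'' ∧ g ≫ h' = f' ≫ m ∧ h' ≫ n = g' ∧
      Realizes m n (extPush E f' δ') ∧ extPull E m δ'' = δ ∧ extPush E f δ'' = extPull E n δ'
  /-- (ET4)ᵒᵖ: for `d -f'→ a -f→ b` realizing `δ` and `q -g'→ b -g→ c` realizing `δ'`. -/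
  et4_op : ∀ {a b c d q : C} {f' : d ⟶ a} {f : a ⟶ b} {δ : ExtModule E b d}
    {g' : q ⟶ b} {g : b ⟶ c} {δ' : ExtModule E c q},
    Realizes f' f δ → Realizes g' g δ' →
    ∃ (e : C) (h' : e ⟶ a) (m : d ⟶ e) (n : e ⟶ q) (δ'' : ExtModule E c e),
      Realizes h' (f ≫ g) δ'' ∧ h' ≫ f = n ≫ g' ∧ m ≫ h' = f' ∧
      Realizes m n (extPull E g' δ) ∧ extPush E n δ'' = δ' ∧ extPush E m δ = extPull E g δ''

namespace Extriangulation

variable {k : Type t} [Field k] {C : Type u} [Category.{v} C] [Preadditive C]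
    [Linear k C] [HasZeroObject C] [HasBinaryBiproducts C] (X : Extriangulation.{t, w, v, u} k C)

/-- `a ⟶ b ⟶ c` is a conflation. -/
def IsConflation {a b c : C} (x : a ⟶ b) (y : b ⟶ c) : Prop :=
  ∃ δ : ExtModule X.E c a, X.Realizes x y δ

def IsInflation {a b : C} (x : a ⟶ b) : Prop :=
  ∃ (c : C) (y : b ⟶ c), X.IsConflation x y

def IsDeflation {b c : C} (y : b ⟶ c) : Prop :=
  ∃ (a : C) (x : a ⟶ b), X.IsConflation x y

/-! ## 0-Auslander extriangulated categories -/

/-- The `𝔼`-projective objects. -/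
def proj : ObjectProperty C := fun p => ∀ (a : C) (δ : ExtModule X.E p a), δ = 0

/-- The `𝔼`-injective objects. -/
def inj : ObjectProperty C := fun i => ∀ (c : C) (δ : ExtModule X.E c i), δ = 0

/-- The projective-injective objects. -/
def projInj : ObjectProperty C := fun q => X.proj q ∧ X.inj q

def HasEnoughProjectives : Prop :=
  ∀ x : C, ∃ (q : C) (π : q ⟶ x), X.proj q ∧ X.IsDeflation π

/-- `(C, 𝔼)` is hereditary: each functor `𝔼(z, -)` is right exact, i.e. sends a conflation
`a ⟶ b ⟶ c` to an exact sequence `𝔼(z, a) → 𝔼(z, b) → 𝔼(z, c) → 0`. -/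
def IsHereditary : Prop :=
  ∀ {a b c : C} (x : a ⟶ b) (y : b ⟶ c), X.IsConflation x y → ∀ z : C,
    Function.Exact (extPush X.E (c := z) x) (extPush X.E (c := z) y) ∧
      Function.Surjective (extPush X.E (c := z) y)

structure IsZeroAuslander : Prop where
  enough_projectives : X.HasEnoughProjectives
  hereditary : X.IsHereditary
  exists_inflation : ∀ p : C, X.proj p → ∃ (q : C) (i : p ⟶ q), X.projInj q ∧ X.IsInflation i

/-! ## Rigid subcategories, perpendicular subcategories and closures -/

/-- A rigid subcategory: closed under isomorphism, with `𝔼ⁱ(r, r') = 0` for all `i ≥ 1` and all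
objects `r`, `r'` of it. -/
structure IsRigid (R : ObjectProperty C) : Prop where
  iso_closed : ∀ {x y : C}, Nonempty (x ≅ y) → R x → R y
  ext_vanish : ∀ r r' : C, R r → R r' → HigherExtVanish X.E r r'

/-- `P^⊥`: the objects `y` with `𝔼ⁱ(x, y) = 0` for all `x` in `P` and `i ≥ 1`. -/
def rightPerp (P : ObjectProperty C) : ObjectProperty C :=
  fun y => ∀ x : C, P x → HigherExtVanish X.E x y

/-- `^⊥P`: the objects `y` with `𝔼ⁱ(y, x) = 0` for all `x` in `P` and `i ≥ 1`. -/
def leftPerp (P : ObjectProperty C) : ObjectProperty C :=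
  fun y => ∀ x : C, P x → HigherExtVanish X.E y x

def IsExtensionClosed (P : ObjectProperty C) : Prop :=
  ∀ {a b c : C} (x : a ⟶ b) (y : b ⟶ c), X.IsConflation x y → P a → P c → P b

def IsClosedUnderCones (P : ObjectProperty C) : Prop :=
  ∀ {a b c : C} (x : a ⟶ b) (y : b ⟶ c), X.IsConflation x y → P a → P b → P c

def IsClosedUnderCocones (P : ObjectProperty C) : Prop :=
  ∀ {a b c : C} (x : a ⟶ b) (y : b ⟶ c), X.IsConflation x y → P b → P c → P a

/-- `P^∨`: the smallest full subcategory containing `P` and closed under extensions, cocones and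
direct summands. -/
def vee (P : ObjectProperty C) : ObjectProperty C := fun x =>
  ∀ Q : ObjectProperty C, P ≤ Q → X.IsExtensionClosed Q → X.IsClosedUnderCocones Q →
    IsClosedUnderSummands Q → Q x

/-- `P^∧`: the smallest full subcategory containing `P` and closed under extensions, cones and
direct summands. -/
def wedge (P : ObjectProperty C) : ObjectProperty C := fun x =>
  ∀ Q : ObjectProperty C, P ≤ Q → X.IsExtensionClosed Q → X.IsClosedUnderCones Q →
    IsClosedUnderSummands Q → Q x

/-! ## Bongartz completions -/

/-- `R` admits a maximal Bongartz completion: every injective object `y` admits a deflation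
`r' ⟶ y` which is a right `add(R, proj ∩ inj)`-approximation. -/
def AdmitsMaximalBongartzCompletion (R : ObjectProperty C) : Prop :=
  ∀ y : C, X.inj y → ∃ (r' : C) (p : r' ⟶ y), X.IsDeflation p ∧
    IsRightApproximation (additiveClosure (R ⊔ X.projInj)) p

/-- `R` admits a minimal Bongartz completion: every projective object `y` admits an inflation
`y ⟶ r'` which is a left `add(R, proj ∩ inj)`-approximation. -/
def AdmitsMinimalBongartzCompletion (R : ObjectProperty C) : Prop :=
  ∀ y : C, X.proj y → ∃ (r' : C) (i : y ⟶ r'), X.IsInflation i ∧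
    IsLeftApproximation (additiveClosure (R ⊔ X.projInj)) i

def AdmitsBongartzCompletions (R : ObjectProperty C) : Prop :=
  X.AdmitsMaximalBongartzCompletion R ∧ X.AdmitsMinimalBongartzCompletion R

/-! ## Cotorsion pairs -/

/-- The standing assumptions on the two members of a left or right cotorsion pair, and (CT2):
any morphism from `U` to `V` factors through an object of `U ∩ V`. -/
structure IsPreCotorsionPair (U V : ObjectProperty C) : Prop where
  additive_left : IsAdditiveSubcategory U
  additive_right : IsAdditiveSubcategory V
  summands_left : IsClosedUnderSummands U
  summands_right : IsClosedUnderSummands V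
  ct2 : ∀ {a b : C} (f : a ⟶ b), U a → V b →
    ∃ (m : C) (g : a ⟶ m) (h : m ⟶ b), U m ∧ V m ∧ g ≫ h = f

/-- Left cotorsion pairs: every `x` admits a conflation `x ⟶ b ⟶ a` with `x ⟶ b` a left
`V`-approximation and `a` in `U`. -/
structure IsLeftCotorsionPair (U V : ObjectProperty C) : Prop extends
    IsPreCotorsionPair U V where
  ct3l : ∀ x : C, ∃ (b a : C) (i : x ⟶ b) (q : b ⟶ a),
    X.IsConflation i q ∧ IsLeftApproximation V i ∧ U a

/-- Right cotorsion pairs: every `x` admits a conflation `b ⟶ a ⟶ x` with `a ⟶ x` a right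
`U`-approximation and `b` in `V`. -/
structure IsRightCotorsionPair (U V : ObjectProperty C) : Prop extends
    IsPreCotorsionPair U V where
  ct3r : ∀ x : C, ∃ (b a : C) (j : b ⟶ a) (p : a ⟶ x),
    X.IsConflation j p ∧ IsRightApproximation U p ∧ V b

/-- `((U, V), (S, T))` is a generalized concentric twin cotorsion pair. -/
structure IsGCTCP (U V S T : ObjectProperty C) : Prop where
  left : X.IsLeftCotorsionPair U V
  right : X.IsRightCotorsionPair S T
  le_left : U ≤ S
  le_right : T ≤ V
  concentric : U ⊓ V = S ⊓ T

/-- Condition (gCP): `((R^∨, R^⊥), (^⊥R, R^∧))` is a generalized concentric twin cotorsion pair. -/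
def GCP (R : ObjectProperty C) : Prop :=
  X.IsGCTCP (X.vee R) (X.rightPerp R) (X.leftPerp R) (X.wedge R)

end Extriangulation

/-! Right exactness of `𝔼(z, -)` kills all higher extensions, so the perpendicular subcategories are
defined by vanishing of `𝔼` alone; it also forces `𝔼(-, v)` to be right exact. What remains is
diagram chasing with extension classes.

For maximal completions, every `x` has a coresolution `x ⟶ e ⟶ i` by injectives, with class `ε`, and
every class in `𝔼(s, x)` is a pullback of `ε` along some `s ⟶ i`. If `p : r' ⟶ i` is an
approximation, `p^* ε` is itself pulled back from a class `δ` over an object of `R`, since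
projective-injectives contribute no extensions. All classes from `R` to `x` are then pullbacks of
`δ`, so they die in the middle term of `δ`, which therefore lies in `R^⊥`. Conversely, for `y`
injective, take a conflation `x ⟶ q ⟶ y` with `q` projective-injective, and the conflation `x ⟶ b ⟶
r` given by the cotorsion pair. The latter is a pullback of the former along some `g : r ⟶ y`, and
`q ⊞ r ⟶ y` is the required approximation. Minimal completions are dual.

For (gCP), the point is that every object of `R^∨` has a conflation `x ⟶ r ⟶ r'` with `r`, `r'` in
`R`, and dually for `R^∧`. It suffices that the objects with such a conflation are closed under
extensions, cocones and summands (`vee_le_twoTermCoresolved`); cocones and summands use Schanuel's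
lemma. These conflations give `R^∨ ⊆ ^⊥R`, and they split when `x` is in `R^⊥`, so `R^∨ ∩ R^⊥ = R`.
-/

section BifunctorLemmas

variable {k : Type t} [Field k] {C : Type u} [Category.{v} C] (E : Cᵒᵖ ⥤ C ⥤ ModuleCat.{w} k)

/-! ### Functoriality of `𝔼` and vanishing of coends -/

@[simp]
lemma extPush_id {c a : C} (δ : ExtModule E c a) : extPush E (𝟙 a) δ = δ := by
  simp [extPush]

@[simp]
lemma extPull_id {c a : C} (δ : ExtModule E c a) : extPull E (𝟙 c) δ = δ := by
  simp [extPull]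

lemma extPush_comp {c a a' a'' : C} (f : a ⟶ a') (g : a' ⟶ a'') (δ : ExtModule E c a) :
    extPush E (f ≫ g) δ = extPush E g (extPush E f δ) := by
  simp [extPush]

lemma extPull_comp {c c' c'' a : C} (f : c'' ⟶ c') (g : c' ⟶ c) (δ : ExtModule E c a) :
    extPull E (f ≫ g) δ = extPull E f (extPull E g δ) := by
  simp [extPull]

-- In the coend `f` moves across the tensor sign, turning `ξ ⊗ f_* η` into `f^* ξ ⊗ η`, which is
-- zero here.
open Classical in
lemma lof_tmul_extPush_mem (F : Cᵒᵖ ⥤ ModuleCat.{max u w} k) {c x x' : C} (f : x ⟶ x')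
    (ξ : F.obj (op x')) (η : ExtModule E c x) (h : (F.map f.op).hom ξ = 0) :
    DirectSum.lof k C (fun x : C => (F.obj (op x) : Type (max u w)) ⊗[k] ExtModule E c x) x'
      (ξ ⊗ₜ[k] extPush E f η) ∈ coendRelations E F c := by
  have hz : _ ∈ coendRelations E F c := Submodule.subset_span ⟨x, x', f, ξ, η, rfl⟩
  rw [h, TensorProduct.zero_tmul, map_zero, zero_sub] at hz
  exact (Submodule.neg_mem_iff _).1 hz

open Classical in
/-- A coend vanishes as soon as all its elementary tensors are relations. -/
lemma coendTensor_eq_zero (F : Cᵒᵖ ⥤ ModuleCat.{max u w} k) (c : C)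
    (h : ∀ (x : C) (ξ : F.obj (op x)) (η : ExtModule E c x),
      DirectSum.lof k C (fun x : C => (F.obj (op x) : Type (max u w)) ⊗[k] ExtModule E c x) x
        (ξ ⊗ₜ[k] η) ∈ coendRelations E F c)
    (z : (coendTensor E F).obj (op c)) : z = 0 := by
  obtain ⟨z, rfl⟩ := Submodule.Quotient.mk_surjective _ z
  refine (Submodule.Quotient.mk_eq_zero _).2 ?_
  induction z using DirectSum.induction_on with
  | zero => exact Submodule.zero_mem _
  | of x t =>
    change DirectSum.lof k C
      (fun x : C => (F.obj (op x) : Type (max u w)) ⊗[k] ExtModule E c x) x t ∈ _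
    induction t using TensorProduct.induction_on with
    | zero => rw [map_zero]; exact Submodule.zero_mem _
    | tmul ξ η => exact h x ξ η
    | add s t hs ht => rw [map_add]; exact Submodule.add_mem _ hs ht
  | add s t hs ht => exact Submodule.add_mem _ hs ht

end BifunctorLemmas

namespace Extriangulation

variable {k : Type t} [Field k] {C : Type u} [Category.{v} C] [Preadditive C]
    [Linear k C] [HasZeroObject C] [HasBinaryBiproducts C] (X : Extriangulation.{t, w, v, u} k C)

lemma push_zero_hom {c a a' : C} (δ : ExtModule X.E c a) :
    extPush X.E (0 : a ⟶ a') δ = 0 := by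
  simpa using X.push_smul (0 : k) (0 : a ⟶ a') δ

lemma pull_zero_hom {c c' a : C} (δ : ExtModule X.E c a) :
    extPull X.E (0 : c' ⟶ c) δ = 0 := by
  simpa using X.pull_smul (0 : k) (0 : c' ⟶ c) δ

lemma push_sub {c a a' : C} (f g : a ⟶ a') (δ : ExtModule X.E c a) :
    extPush X.E (f - g) δ = extPush X.E f δ - extPush X.E g δ := by
  rw [eq_sub_iff_add_eq, ← X.push_add, sub_add_cancel]

lemma pull_sub {c c' a : C} (f g : c' ⟶ c) (δ : ExtModule X.E c a) :
    extPull X.E (f - g) δ = extPull X.E f δ - extPull X.E g δ := by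
  rw [eq_sub_iff_add_eq, ← X.pull_add, sub_add_cancel]

/-! ## Exact sequences -/

section Exact

variable {X} {a b c : C} {x : a ⟶ b} {y : b ⟶ c} {δ : ExtModule X.E c a}

/-- Compare with the split sequence `a ⟶ a ⊞ z ⟶ z` for a zero object `z`: (ET3) factors `biprod.fst
≫ x ≫ y` through `biprod.snd`, and restricting to `a` gives zero. -/
lemma Realizes.comp_eq_zero (h : X.Realizes x y δ) : x ≫ y = 0 := by
  obtain ⟨z, hz⟩ := HasZeroObject.zero (C := C)
  obtain ⟨f, hf, -⟩ := X.et3 (X.realizes_zero a z) h (𝟙 a) (biprod.fst ≫ x) (by simp)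
  have := congrArg (fun g => (biprod.inl : a ⟶ a ⊞ z) ≫ g) hf
  simpa using this.symm

/-- The split sequence `a ⟶ a ⊞ b ⟶ b` maps to the given one by `(x, 1)` in the middle and `y` on
the right, so (ET3)ᵒᵖ exhibits `y^* δ` as a pushforward of the zero class. -/
lemma Realizes.pull_self (h : X.Realizes x y δ) : extPull X.E y δ = 0 := by
  obtain ⟨f, -, hf⟩ := X.et3_op (X.realizes_zero a b) h (biprod.desc x (𝟙 b)) y
    (by ext <;> simp [h.comp_eq_zero])
  rw [← hf, map_zero]

lemma Realizes.push_self (h : X.Realizes x y δ) : extPush X.E x δ = 0 := by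
  obtain ⟨f, -, hf⟩ := X.et3 h (X.realizes_zero b c) x (biprod.lift (𝟙 b) y)
    (by ext <;> simp [h.comp_eq_zero])
  rw [hf, map_zero]

/-- Exactness of `Hom(b, v) → Hom(a, v) → 𝔼(c, v)`. -/
lemma Realizes.exists_extension (h : X.Realizes x y δ) {v : C} (f : a ⟶ v)
    (hf : extPush X.E f δ = 0) : ∃ g : b ⟶ v, x ≫ g = f := by
  obtain ⟨g, hg, -⟩ := X.realizes_lift h (X.realizes_zero v c) f (𝟙 c) (by simpa using hf)
  exact ⟨g ≫ biprod.fst, by rw [← Category.assoc, hg]; simp⟩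

/-- Exactness of `Hom(s, b) → Hom(s, c) → 𝔼(s, a)`. -/
lemma Realizes.exists_lift (h : X.Realizes x y δ) {s : C} (f : s ⟶ c)
    (hf : extPull X.E f δ = 0) : ∃ g : s ⟶ b, g ≫ y = f := by
  obtain ⟨g, -, hg⟩ := X.realizes_lift (X.realizes_zero a s) h (𝟙 a) f (by simpa using hf.symm)
  exact ⟨biprod.inr ≫ g, by rw [Category.assoc, ← hg]; simp⟩

/-- Exactness of `Hom(s, c) → 𝔼(s, a) → 𝔼(s, b)`. -/
lemma Realizes.exists_pull (h : X.Realizes x y δ) {s : C} (ξ : ExtModule X.E s a)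
    (hξ : extPush X.E x ξ = 0) : ∃ f : s ⟶ c, extPull X.E f δ = ξ := by
  obtain ⟨m, i, p, hm⟩ := X.exists_realizes ξ
  obtain ⟨g, hg⟩ := hm.exists_extension x hξ
  obtain ⟨f, -, hf⟩ := X.et3 hm h (𝟙 a) g (by simpa using hg)
  exact ⟨f, by simpa using hf.symm⟩

/-- Exactness of `Hom(a, v) → 𝔼(c, v) → 𝔼(b, v)`. -/
lemma Realizes.exists_push (h : X.Realizes x y δ) {v : C} (ξ : ExtModule X.E c v)
    (hξ : extPull X.E y ξ = 0) : ∃ f : a ⟶ v, extPush X.E f δ = ξ := by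
  obtain ⟨m, i, p, hm⟩ := X.exists_realizes ξ
  obtain ⟨g, hg⟩ := hm.exists_lift y hξ
  obtain ⟨f, -, hf⟩ := X.et3_op h hm g (𝟙 c) (by simpa using hg.symm)
  exact ⟨f, by simpa using hf⟩

lemma Realizes.exists_retraction (h : X.Realizes x y 0) : ∃ r : b ⟶ a, x ≫ r = 𝟙 a :=
  h.exists_extension (𝟙 a) (map_zero _)

lemma Realizes.nonempty_iso_biprod (h : X.Realizes x y 0) : Nonempty (b ≅ a ⊞ c) := by
  obtain ⟨e, -⟩ := X.realizes_unique h (X.realizes_zero a c)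
  exact ⟨e⟩

/-- Exactness of `𝔼(c, v) → 𝔼(b, v) → 𝔼(a, v)`. -/
lemma Realizes.exists_pull_of_pull_eq_zero (h : X.Realizes x y δ) {v : C} (ξ : ExtModule X.E b v)
    (hξ : extPull X.E x ξ = 0) : ∃ η : ExtModule X.E c v, extPull X.E y η = ξ := by
  obtain ⟨m, i, p, hm⟩ := X.exists_realizes ξ
  -- The kernel `e` of `m ⟶ b ⟶ c` is an extension of `a` by `v` with class `x^* ξ = 0`. A
  -- retraction `e ⟶ v` pushes the class `δ''` of `e ⟶ m ⟶ c` to the required preimage.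
  obtain ⟨e, h', m', n, δ'', -, -, -, hs, -, hy⟩ := X.et4_op hm h
  rw [hξ] at hs
  obtain ⟨r, hr⟩ := hs.exists_retraction
  refine ⟨extPush X.E r δ'', ?_⟩
  rw [extPull_extPush, ← hy, ← extPush_comp, hr, extPush_id]

lemma realizes_of_biprod_iso {z x y : C} (e : z ≅ x ⊞ y) :
    X.Realizes (biprod.inl ≫ e.inv) (e.hom ≫ biprod.snd) (0 : ExtModule X.E y x) :=
  X.realizes_of_iso (X.realizes_zero x y) e.symm rfl (by simp)

lemma realizes_zero_symm (a c : C) :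
    X.Realizes (biprod.inr : a ⟶ c ⊞ a) (biprod.fst : c ⊞ a ⟶ c) (0 : ExtModule X.E c a) :=
  X.realizes_of_iso (X.realizes_zero a c) (biprod.braiding a c)
    (by ext <;> simp) (by simp)

lemma IsInflation.comp {a b c : C} {f : a ⟶ b} {g : b ⟶ c} (hf : X.IsInflation f)
    (hg : X.IsInflation g) : X.IsInflation (f ≫ g) := by
  obtain ⟨d, f', δ, hδ⟩ := hf
  obtain ⟨q, g', δ', hδ'⟩ := hg
  obtain ⟨e, h', -, -, δ'', h, -⟩ := X.et4 hδ hδ'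
  exact ⟨e, h', δ'', h⟩

lemma IsDeflation.comp {a b c : C} {f : a ⟶ b} {g : b ⟶ c} (hf : X.IsDeflation f)
    (hg : X.IsDeflation g) : X.IsDeflation (f ≫ g) := by
  obtain ⟨d, f', δ, hδ⟩ := hf
  obtain ⟨q, g', δ', hδ'⟩ := hg
  obtain ⟨e, h', -, -, δ'', h, -⟩ := X.et4_op hδ hδ'
  exact ⟨e, h', δ'', h⟩

end Exact

end Extriangulation

namespace Extriangulation

variable {k : Type t} [Field k] {C : Type u} [Category.{v} C] [Preadditive C]
    [Linear k C] [HasZeroObject C] [HasBinaryBiproducts C] (X : Extriangulation.{t, w, v, u} k C)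

/-! ## Vanishing of `𝔼` -/

/-- `𝔼(c, a) = 0`. -/
def ExtVanish (c a : C) : Prop := ∀ δ : ExtModule X.E c a, δ = 0

section ExtVanish

variable {X} {a b c z : C} {x : a ⟶ b} {y : b ⟶ c} {δ : ExtModule X.E c a}

lemma ExtVanish.of_retract_left (h : X.ExtVanish b z) (s : a ⟶ b) (r : b ⟶ a)
    (hsr : s ≫ r = 𝟙 a) : X.ExtVanish a z := fun ξ => by
  rw [← extPull_id X.E ξ, ← hsr, extPull_comp, h (extPull X.E r ξ), map_zero]

lemma ExtVanish.of_retract_right (h : X.ExtVanish z b) (s : a ⟶ b) (r : b ⟶ a)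
    (hsr : s ≫ r = 𝟙 a) : X.ExtVanish z a := fun ξ => by
  rw [← extPush_id X.E ξ, ← hsr, extPush_comp, h (extPush X.E s ξ), map_zero]

lemma ExtVanish.of_isZero_left (h : IsZero a) : X.ExtVanish a z := fun ξ => by
  rw [← extPull_id X.E ξ, h.eq_of_src (𝟙 a) 0, X.pull_zero_hom]

lemma ExtVanish.of_isZero_right (h : IsZero a) : X.ExtVanish z a := fun ξ => by
  rw [← extPush_id X.E ξ, h.eq_of_src (𝟙 a) 0, X.push_zero_hom]

lemma Realizes.extVanish_middle_left (h : X.Realizes x y δ) (ha : X.ExtVanish a z)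
    (hc : X.ExtVanish c z) : X.ExtVanish b z := fun ξ => by
  obtain ⟨η, rfl⟩ := h.exists_pull_of_pull_eq_zero ξ (ha _)
  rw [hc η, map_zero]

/-- For hereditary `(C, 𝔼)`, the functor `𝔼(-, v)` is right exact. -/
lemma IsHereditary.pull_surjective (hX : X.IsHereditary) (h : X.Realizes x y δ) (v : C) :
    Function.Surjective (extPull X.E (a := v) x) := fun ξ => by
  obtain ⟨m, i, p, hm⟩ := X.exists_realizes ξ
  -- Right exactness is assumed only in the second variable: it lifts `δ` along `p`, and (ET4) then
  -- yields an extension `δ''` by `v` that restricts to `ξ`, over an object identified with `b`.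
  obtain ⟨ε, hε⟩ := (hX i p ⟨ξ, hm⟩ c).2 δ
  obtain ⟨n, j, q, hn⟩ := X.exists_realizes ε
  obtain ⟨e, h', m', n', δ'', -, -, -, hs, hξ, -⟩ := X.et4 hm hn
  rw [hε] at hs
  obtain ⟨f, hf, -⟩ := X.realizes_unique h hs
  exact ⟨extPull X.E f.hom δ'', by rw [← extPull_comp, hf, hξ]⟩

lemma Realizes.extVanish_middle_right (h : X.Realizes x y δ) (hX : X.IsHereditary)
    (ha : X.ExtVanish z a) (hc : X.ExtVanish z c) : X.ExtVanish z b := fun ξ => by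
  obtain ⟨η, rfl⟩ := ((hX x y ⟨δ, h⟩ z).1 ξ).1 (hc _)
  rw [ha η, map_zero]

lemma Realizes.extVanish_cone (h : X.Realizes x y δ) (hX : X.IsHereditary)
    (hb : X.ExtVanish z b) : X.ExtVanish z c := fun ξ => by
  obtain ⟨η, rfl⟩ := (hX x y ⟨δ, h⟩ z).2 ξ
  rw [hb η, map_zero]

lemma Realizes.extVanish_cocone (h : X.Realizes x y δ) (hX : X.IsHereditary)
    (hb : X.ExtVanish b z) : X.ExtVanish a z := fun ξ => by
  obtain ⟨η, rfl⟩ := hX.pull_surjective h z ξ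
  rw [hb η, map_zero]

lemma ExtVanish.biprod_left (ha : X.ExtVanish a z) (hb : X.ExtVanish b z) :
    X.ExtVanish (a ⊞ b) z :=
  (X.realizes_zero a b).extVanish_middle_left ha hb

lemma ExtVanish.biprod_right (hX : X.IsHereditary) (ha : X.ExtVanish z a)
    (hb : X.ExtVanish z b) : X.ExtVanish z (a ⊞ b) :=
  (X.realizes_zero a b).extVanish_middle_right hX ha hb

/-- A conflation with vanishing `𝔼(c, a)` splits. -/
lemma Realizes.nonempty_iso_biprod_of_extVanish (h : X.Realizes x y δ) (hv : X.ExtVanish c a) :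
    Nonempty (b ≅ a ⊞ c) := by
  obtain rfl := hv δ
  exact h.nonempty_iso_biprod

end ExtVanish

/-- For a tensor `ξ ⊗ η` with `ξ` realized by `a ⟶ b ⟶ x`, right exactness lifts `η` to `𝔼(c, b)`.
Moving the deflation `p : b ⟶ x` across the tensor sign leaves `p^* ξ = 0`. Higher degrees follow
since one tensor factor is already zero. -/
lemma higherExt_succ_eq_zero {X : Extriangulation.{t, w, v, u} k C} (hX : X.IsHereditary) (a : C)
    (n : ℕ) (c : C) (ξ : (higherExt X.E a (n + 1)).obj (op c)) : ξ = 0 := by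
  induction n generalizing c with
  | zero =>
    refine coendTensor_eq_zero X.E _ c (fun x ξ η => ?_) ξ
    obtain ⟨b, i, p, h⟩ := X.exists_realizes (c := x) (a := a) (ULift.down ξ)
    obtain ⟨η, rfl⟩ := (hX i p ⟨_, h⟩ c).2 η
    exact lof_tmul_extPush_mem X.E _ p ξ η (congrArg ULift.up h.pull_self)
  | succ n ih =>
    refine coendTensor_eq_zero X.E _ c (fun x ξ η => ?_) ξ
    rw [ih x ξ, TensorProduct.zero_tmul, map_zero]
    exact Submodule.zero_mem _

lemma IsHereditary.higherExtVanish_iff {X : Extriangulation.{t, w, v, u} k C}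
    (hX : X.IsHereditary) {c a : C} : HigherExtVanish X.E c a ↔ X.ExtVanish c a := by
  refine ⟨fun h δ => congrArg ULift.down (h 0 (ULift.up δ)), fun h n ξ => ?_⟩
  cases n with
  | zero => exact congrArg ULift.up (h (ULift.down ξ))
  | succ n => exact higherExt_succ_eq_zero hX a n c ξ

/-! ## Schanuel's lemma -/

section Schanuel

variable {X}

/-- An extension of `d` by `z` and a conflation `c ⟶ d ⟶ c'` give a conflation `b ⟶ m ⟶ c'`,
where `b` is the middle term of the restricted extension of `c` by `z`. -/
lemma Realizes.exists_conflation_of_pull {z m d b c c' : C} {i : z ⟶ m} {p : m ⟶ d}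
    {ξ : ExtModule X.E d z} (h : X.Realizes i p ξ) {j : c ⟶ d} {q : d ⟶ c'}
    {ζ : ExtModule X.E c' c} (hs : X.Realizes j q ζ) {x : z ⟶ b} {y : b ⟶ c}
    (hb : X.Realizes x y (extPull X.E j ξ)) :
    ∃ (e : C) (l : e ⟶ m) (r : m ⟶ c'), Nonempty (e ≅ b) ∧ X.IsConflation l r := by
  obtain ⟨e, h', m', n, δ'', hc, -, -, hz, -, -⟩ := X.et4_op h hs
  obtain ⟨f, -⟩ := X.realizes_unique hz hb
  exact ⟨e, h', _, ⟨f⟩, δ'', hc⟩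

lemma Realizes.exists_conflation_of_push {a z m d b d' : C} {i : d ⟶ m} {p : m ⟶ a}
    {ξ : ExtModule X.E a d} (h : X.Realizes i p ξ) {j : d' ⟶ d} {q : d ⟶ z}
    {ζ : ExtModule X.E z d'} (hs : X.Realizes j q ζ) {x : z ⟶ b} {y : b ⟶ a}
    (hb : X.Realizes x y (extPush X.E q ξ)) :
    ∃ (e : C) (l : d' ⟶ m) (r : m ⟶ e), Nonempty (e ≅ b) ∧ X.IsConflation l r := by
  obtain ⟨e, h', m', n, δ'', hc, -, -, hz, -, -⟩ := X.et4 hs h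
  obtain ⟨f, -⟩ := X.realizes_unique hz hb
  exact ⟨e, _, h', ⟨f⟩, δ'', hc⟩

lemma IsConflation.nonempty_iso_biprod_left {a a' b c : C} {x : a ⟶ b} {y : b ⟶ c}
    (h : X.IsConflation x y) (f : a ≅ a') (hv : X.ExtVanish c a') : Nonempty (b ≅ a' ⊞ c) := by
  obtain ⟨δ, hδ⟩ := h
  obtain ⟨g⟩ := hδ.nonempty_iso_biprod_of_extVanish (hv.of_retract_right f.hom f.inv (by simp))
  exact ⟨g ≪≫ biprod.mapIso f (Iso.refl _)⟩

lemma IsConflation.nonempty_iso_biprod_right {a b c c' : C} {x : a ⟶ b} {y : b ⟶ c}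
    (h : X.IsConflation x y) (f : c ≅ c') (hv : X.ExtVanish c' a) : Nonempty (b ≅ a ⊞ c') := by
  obtain ⟨δ, hδ⟩ := h
  obtain ⟨g⟩ := hδ.nonempty_iso_biprod_of_extVanish (hv.of_retract_left f.hom f.inv (by simp))
  exact ⟨g ≪≫ biprod.mapIso (Iso.refl _) f⟩

/-- Schanuel's lemma for two conflations starting at `z`. -/
lemma Realizes.schanuel {z b c b' c' : C} {x : z ⟶ b} {y : b ⟶ c} {δ : ExtModule X.E c z}
    {x' : z ⟶ b'} {y' : b' ⟶ c'} {δ' : ExtModule X.E c' z} (h : X.Realizes x y δ)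
    (h' : X.Realizes x' y' δ') (hv : X.ExtVanish c' b) (hv' : X.ExtVanish c b') :
    Nonempty (b ⊞ c' ≅ b' ⊞ c) := by
  -- The middle term `m` of this combined class plays the role of a pushout of `b` and `b'` under
  -- `z`. It sits in conflations from `b` to `c'` and from `b'` to `c`, both of which split.
  obtain ⟨m, i, p, hm⟩ := X.exists_realizes
    (extPull X.E (biprod.fst : c ⊞ c' ⟶ c) δ + extPull X.E (biprod.snd : c ⊞ c' ⟶ c') δ')
  obtain ⟨e, l, r, ⟨f⟩, hl⟩ := hm.exists_conflation_of_pull (X.realizes_zero c c') (x := x) (y := y)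
    (by rw [map_add, ← extPull_comp, ← extPull_comp, biprod.inl_fst, biprod.inl_snd,
      X.pull_zero_hom, extPull_id, add_zero]; exact h)
  obtain ⟨e', l', r', ⟨f'⟩, hl'⟩ := hm.exists_conflation_of_pull (X.realizes_zero_symm c' c)
    (x := x') (y := y')
    (by rw [map_add, ← extPull_comp, ← extPull_comp, biprod.inr_fst, biprod.inr_snd,
      X.pull_zero_hom, extPull_id, zero_add]; exact h')
  obtain ⟨g⟩ := hl.nonempty_iso_biprod_left f hv
  obtain ⟨g'⟩ := hl'.nonempty_iso_biprod_left f' hv'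
  exact ⟨g.symm ≪≫ g'⟩

/-- Schanuel's lemma for two conflations ending at `z`. -/
lemma Realizes.schanuel_op {z a b a' b' : C} {x : a ⟶ b} {y : b ⟶ z} {δ : ExtModule X.E z a}
    {x' : a' ⟶ b'} {y' : b' ⟶ z} {δ' : ExtModule X.E z a'} (h : X.Realizes x y δ)
    (h' : X.Realizes x' y' δ') (hv : X.ExtVanish b a') (hv' : X.ExtVanish b' a) :
    Nonempty (b ⊞ a' ≅ b' ⊞ a) := by
  obtain ⟨m, i, p, hm⟩ := X.exists_realizes
    (extPush X.E (biprod.inl : a ⟶ a ⊞ a') δ + extPush X.E (biprod.inr : a' ⟶ a ⊞ a') δ')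
  obtain ⟨e, l, r, ⟨f⟩, hl⟩ := hm.exists_conflation_of_push (X.realizes_zero a a')
    (x := x') (y := y')
    (by rw [map_add, ← extPush_comp, ← extPush_comp, biprod.inl_snd, biprod.inr_snd,
      X.push_zero_hom, extPush_id, zero_add]; exact h')
  obtain ⟨e', l', r', ⟨f'⟩, hl'⟩ := hm.exists_conflation_of_push (X.realizes_zero_symm a' a)
    (x := x) (y := y)
    (by rw [map_add, ← extPush_comp, ← extPush_comp, biprod.inl_fst, biprod.inr_fst,
      X.push_zero_hom, extPush_id, add_zero]; exact h)
  obtain ⟨g⟩ := hl.nonempty_iso_biprod_right f hv'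
  obtain ⟨g'⟩ := hl'.nonempty_iso_biprod_right f' hv
  exact ⟨biprod.braiding _ _ ≪≫ g'.symm ≪≫ g ≪≫ biprod.braiding _ _⟩

end Schanuel

end Extriangulation

/-! ### Additive closures -/

section AdditiveClosure

variable {C : Type u} [Category.{v} C] [Preadditive C] [HasBinaryBiproducts C]

/-- The additive closure is the smallest additive subcategory. -/
lemma additiveClosure_le {P Q : ObjectProperty C} (hQ : IsAdditiveSubcategory Q) (h : P ≤ Q) :
    additiveClosure P ≤ Q :=
  fun _ hx => hx Q hQ h

lemma le_additiveClosure (P : ObjectProperty C) : P ≤ additiveClosure P :=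
  fun x hx _ _ h => h x hx

lemma additiveClosure_biprod {P : ObjectProperty C} {x y : C} (hx : additiveClosure P x)
    (hy : additiveClosure P y) : additiveClosure P (x ⊞ y) :=
  fun Q hQ h => hQ.biprod_mem (hx Q hQ h) (hy Q hQ h)

end AdditiveClosure

open scoped ZeroObject

namespace Extriangulation

variable {k : Type t} [Field k] {C : Type u} [Category.{v} C] [Preadditive C]
    [Linear k C] [HasZeroObject C] [HasBinaryBiproducts C]

/-! ## Perpendicular subcategories -/

section Perp

variable {X : Extriangulation.{t, w, v, u} k C} {R : ObjectProperty C}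

lemma ExtVanish.of_iso_left {a b z : C} (h : X.ExtVanish a z) (e : a ≅ b) : X.ExtVanish b z :=
  h.of_retract_left e.inv e.hom (by simp)

lemma ExtVanish.of_iso_right {a b z : C} (h : X.ExtVanish z a) (e : a ≅ b) : X.ExtVanish z b :=
  h.of_retract_right e.inv e.hom (by simp)

lemma ExtVanish.of_summand_left {a b c z : C} (h : X.ExtVanish c z) (e : c ≅ a ⊞ b) :
    X.ExtVanish a z :=
  h.of_retract_left (biprod.inl ≫ e.inv) (e.hom ≫ biprod.fst) (by simp)

lemma ExtVanish.of_summand_right {a b c z : C} (h : X.ExtVanish z c) (e : c ≅ a ⊞ b) :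
    X.ExtVanish z a :=
  h.of_retract_right (biprod.inl ≫ e.inv) (e.hom ≫ biprod.fst) (by simp)

lemma isAdditiveSubcategory_extVanish_left (z : C) :
    IsAdditiveSubcategory (C := C) (fun a => X.ExtVanish a z) where
  iso_closed := fun ⟨e⟩ h => h.of_iso_left e
  zero_mem := ⟨0, isZero_zero C, .of_isZero_left (isZero_zero C)⟩
  biprod_mem := fun ha hb => ha.biprod_left hb

lemma isAdditiveSubcategory_extVanish_right (hX : X.IsHereditary) (z : C) :
    IsAdditiveSubcategory (C := C) (fun a => X.ExtVanish z a) where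
  iso_closed := fun ⟨e⟩ h => h.of_iso_right e
  zero_mem := ⟨0, isZero_zero C, .of_isZero_right (isZero_zero C)⟩
  biprod_mem := fun ha hb => ha.biprod_right hX hb

lemma IsHereditary.rightPerp_iff (hX : X.IsHereditary) {y : C} :
    X.rightPerp R y ↔ ∀ r, R r → X.ExtVanish r y :=
  forall₂_congr fun _ _ => hX.higherExtVanish_iff

lemma IsHereditary.leftPerp_iff (hX : X.IsHereditary) {y : C} :
    X.leftPerp R y ↔ ∀ r, R r → X.ExtVanish y r :=
  forall₂_congr fun _ _ => hX.higherExtVanish_iff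

lemma IsHereditary.isAdditiveSubcategory_rightPerp (hX : X.IsHereditary) :
    IsAdditiveSubcategory (X.rightPerp R) where
  iso_closed := fun ⟨e⟩ h => hX.rightPerp_iff.2 fun r hr =>
    (hX.rightPerp_iff.1 h r hr).of_iso_right e
  zero_mem := ⟨0, isZero_zero C, hX.rightPerp_iff.2 fun _ _ => .of_isZero_right (isZero_zero C)⟩
  biprod_mem := fun ha hb => hX.rightPerp_iff.2 fun r hr =>
    (hX.rightPerp_iff.1 ha r hr).biprod_right hX (hX.rightPerp_iff.1 hb r hr)

lemma IsHereditary.isAdditiveSubcategory_leftPerp (hX : X.IsHereditary) :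
    IsAdditiveSubcategory (X.leftPerp R) where
  iso_closed := fun ⟨e⟩ h => hX.leftPerp_iff.2 fun r hr =>
    (hX.leftPerp_iff.1 h r hr).of_iso_left e
  zero_mem := ⟨0, isZero_zero C, hX.leftPerp_iff.2 fun _ _ => .of_isZero_left (isZero_zero C)⟩
  biprod_mem := fun ha hb => hX.leftPerp_iff.2 fun r hr =>
    (hX.leftPerp_iff.1 ha r hr).biprod_left (hX.leftPerp_iff.1 hb r hr)

lemma IsHereditary.isClosedUnderSummands_rightPerp (hX : X.IsHereditary) :
    IsClosedUnderSummands (X.rightPerp R) := fun ⟨e⟩ h => hX.rightPerp_iff.2 fun r hr =>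
  (hX.rightPerp_iff.1 h r hr).of_summand_right e

lemma IsHereditary.isClosedUnderSummands_leftPerp (hX : X.IsHereditary) :
    IsClosedUnderSummands (X.leftPerp R) := fun ⟨e⟩ h => hX.leftPerp_iff.2 fun r hr =>
  (hX.leftPerp_iff.1 h r hr).of_summand_left e

lemma IsRigid.le_rightPerp (hR : X.IsRigid R) : R ≤ X.rightPerp R :=
  fun y hy x hx => hR.ext_vanish x y hx hy

lemma IsRigid.le_leftPerp (hR : X.IsRigid R) : R ≤ X.leftPerp R :=
  fun y hy x hx => hR.ext_vanish y x hy hx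

lemma IsRigid.extVanish (hR : X.IsRigid R) (hX : X.IsHereditary) {r s : C} (hr : R r) (hs : R s) :
    X.ExtVanish r s :=
  hX.higherExtVanish_iff.1 (hR.ext_vanish r s hr hs)

end Perp

/-! ## Approximations by `add(R, proj ∩ inj)` -/

section Approximation

variable {X : Extriangulation.{t, w, v, u} k C} {R : ObjectProperty C}

/-- An extension of an object of `add(R, proj ∩ inj)` is pulled back from an object of `R`. -/
lemma exists_pull_of_additiveClosure (hR : IsAdditiveSubcategory R) {a : C}
    (ha : additiveClosure (R ⊔ X.projInj) a) {z : C} (δ : ExtModule X.E a z) :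
    ∃ (r : C) (f : a ⟶ r) (ε : ExtModule X.E r z), R r ∧ extPull X.E f ε = δ := by
  revert δ
  -- The property defines an additive subcategory. It is trivial on `R`, and holds for
  -- projective-injectives because their extensions vanish.
  refine additiveClosure_le (P := R ⊔ X.projInj) (Q := fun a => ∀ δ : ExtModule X.E a z,
    ∃ (r : C) (f : a ⟶ r) (ε : ExtModule X.E r z), R r ∧ extPull X.E f ε = δ) ⟨?_, ?_, ?_⟩ ?_ a ha
  · rintro x y ⟨e⟩ h δ
    obtain ⟨r, f, ε, hr, hf⟩ := h (extPull X.E e.hom δ)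
    exact ⟨r, e.inv ≫ f, ε, hr, by rw [extPull_comp, hf, ← extPull_comp, e.inv_hom_id, extPull_id]⟩
  · obtain ⟨n, hn, hRn⟩ := hR.zero_mem
    exact ⟨n, hn, fun δ => ⟨n, 𝟙 n, δ, hRn, extPull_id _ _⟩⟩
  · intro x y hx hy δ
    obtain ⟨r, f, ε, hr, hf⟩ := hx (extPull X.E biprod.inl δ)
    obtain ⟨s, g, η, hs, hg⟩ := hy (extPull X.E biprod.inr δ)
    refine ⟨r ⊞ s, biprod.map f g, extPull X.E biprod.fst ε + extPull X.E biprod.snd η,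
      hR.biprod_mem hr hs, ?_⟩
    rw [map_add, ← extPull_comp, ← extPull_comp, biprod.map_fst, biprod.map_snd, extPull_comp,
      extPull_comp, hf, hg, ← extPull_comp, ← extPull_comp, ← X.pull_add, biprod.total, extPull_id]
  · rintro x (hx | hx) δ
    · exact ⟨x, 𝟙 x, δ, hx, extPull_id _ _⟩
    · obtain ⟨n, -, hRn⟩ := hR.zero_mem
      exact ⟨n, 0, 0, hRn, by rw [map_zero, hx.1 z δ]⟩

/-- An extension by an object of `add(R, proj ∩ inj)` is pushed out from an object of `R`. -/
lemma exists_push_of_additiveClosure (hR : IsAdditiveSubcategory R) {a : C}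
    (ha : additiveClosure (R ⊔ X.projInj) a) {z : C} (δ : ExtModule X.E z a) :
    ∃ (r : C) (f : r ⟶ a) (ε : ExtModule X.E z r), R r ∧ extPush X.E f ε = δ := by
  revert δ
  refine additiveClosure_le (P := R ⊔ X.projInj) (Q := fun a => ∀ δ : ExtModule X.E z a,
    ∃ (r : C) (f : r ⟶ a) (ε : ExtModule X.E z r), R r ∧ extPush X.E f ε = δ) ⟨?_, ?_, ?_⟩ ?_ a ha
  · rintro x y ⟨e⟩ h δ
    obtain ⟨r, f, ε, hr, hf⟩ := h (extPush X.E e.inv δ)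
    exact ⟨r, f ≫ e.hom, ε, hr, by rw [extPush_comp, hf, ← extPush_comp, e.inv_hom_id, extPush_id]⟩
  · obtain ⟨n, hn, hRn⟩ := hR.zero_mem
    exact ⟨n, hn, fun δ => ⟨n, 𝟙 n, δ, hRn, extPush_id _ _⟩⟩
  · intro x y hx hy δ
    obtain ⟨r, f, ε, hr, hf⟩ := hx (extPush X.E biprod.fst δ)
    obtain ⟨s, g, η, hs, hg⟩ := hy (extPush X.E biprod.snd δ)
    refine ⟨r ⊞ s, biprod.map f g, extPush X.E biprod.inl ε + extPush X.E biprod.inr η,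
      hR.biprod_mem hr hs, ?_⟩
    rw [map_add, ← extPush_comp, ← extPush_comp, biprod.inl_map, biprod.inr_map, extPush_comp,
      extPush_comp, hf, hg, ← extPush_comp, ← extPush_comp, ← X.push_add, biprod.total, extPush_id]
  · rintro x (hx | hx) δ
    · exact ⟨x, 𝟙 x, δ, hx, extPush_id _ _⟩
    · obtain ⟨n, -, hRn⟩ := hR.zero_mem
      exact ⟨n, 0, 0, hRn, by rw [map_zero, hx.2 z δ]⟩

/-- If `f` is a deflation then so is `(f, g) : b ⊞ r ⟶ c`. -/
lemma IsDeflation.desc {b c r : C} {f : b ⟶ c} (hf : X.IsDeflation f) (g : r ⟶ c) :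
    X.IsDeflation (biprod.desc f g) := by
  obtain ⟨a, i, δ, h⟩ := hf
  -- Factor `(f, g)` as `f ⊕ 1` followed by `(1, g) : c ⊞ r ⟶ c`, a split projection up to a shear
  -- automorphism.
  have h₁ : X.IsDeflation (biprod.map f (𝟙 r)) := by
    have h₀ : X.Realizes (0 : (0 : C) ⟶ r) (𝟙 r) 0 :=
      X.realizes_of_iso (X.realizes_zero 0 r)
        ⟨biprod.snd, biprod.inr, by ext; simp, by simp⟩ (by simp) (by simp)
    exact ⟨_, _, _, X.realizes_biprod h h₀⟩
  have h₂ : X.IsDeflation (biprod.desc (𝟙 c) g) :=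
    ⟨r, biprod.lift (-g) (𝟙 r), 0, X.realizes_of_iso (X.realizes_zero_symm r c)
      ⟨biprod.lift (biprod.fst - biprod.snd ≫ g) biprod.snd,
        biprod.lift (biprod.fst + biprod.snd ≫ g) biprod.snd, by ext <;> simp, by ext <;> simp⟩
      (by ext <;> simp) (by ext <;> simp)⟩
  convert h₁.comp h₂ using 1
  ext <;> simp

/-- If `f` is an inflation then so is `(f, g) : a ⟶ b ⊞ r`. -/
lemma IsInflation.lift {a b r : C} {f : a ⟶ b} (hf : X.IsInflation f) (g : a ⟶ r) :
    X.IsInflation (biprod.lift f g) := by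
  obtain ⟨c, p, δ, h⟩ := hf
  have h₁ : X.IsInflation (biprod.map f (𝟙 r)) := by
    have h₀ : X.Realizes (𝟙 r) (0 : r ⟶ (0 : C)) 0 :=
      X.realizes_of_iso (X.realizes_zero r 0)
        ⟨biprod.fst, biprod.inl, by ext; simp, by simp⟩ (by simp)
        ((isZero_zero C).eq_of_tgt _ _)
    exact ⟨_, _, _, X.realizes_biprod h h₀⟩
  have h₂ : X.IsInflation (biprod.lift (𝟙 a) g) :=
    ⟨r, biprod.desc (-g) (𝟙 r), 0, X.realizes_of_iso (X.realizes_zero a r)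
      ⟨biprod.lift biprod.fst (biprod.snd + biprod.fst ≫ g),
        biprod.lift biprod.fst (biprod.snd - biprod.fst ≫ g), by ext <;> simp, by ext <;> simp⟩
      (by ext <;> simp) (by ext <;> simp)⟩
  convert h₂.comp h₁ using 1
  ext <;> simp

end Approximation

/-! ## Resolutions in 0-Auslander categories -/

namespace IsZeroAuslander

variable {X : Extriangulation.{t, w, v, u} k C} (hX : X.IsZeroAuslander)
include hX

/-- Embed a projective cover `p` of `x` into a projective-injective `q`. Both `e` and `i` are then
cones of inflations into `q`, and right exactness passes injectivity from `q` to them. -/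
lemma exists_injective_coresolution (x : C) :
    ∃ (e i : C) (f : x ⟶ e) (g : e ⟶ i), X.IsConflation f g ∧ X.inj e ∧ X.inj i := by
  obtain ⟨p, π, hp, p', ι, δ, h⟩ := hX.enough_projectives x
  obtain ⟨q, l, hq, i, g, δ', h'⟩ := hX.exists_inflation p hp
  obtain ⟨e, h₁, m, n, δ'', hq', -, -, hm, -, -⟩ := X.et4 h h'
  exact ⟨e, i, m, n, ⟨_, hm⟩, fun z => hq'.extVanish_cone hX.hereditary (hq.2 z),
    fun z => h'.extVanish_cone hX.hereditary (hq.2 z)⟩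

lemma exists_projective_resolution (x : C) :
    ∃ (p' p : C) (f : p' ⟶ p) (g : p ⟶ x), X.IsConflation f g ∧ X.proj p' ∧ X.proj p := by
  obtain ⟨p, π, hp, p', ι, δ, h⟩ := hX.enough_projectives x
  exact ⟨p', p, ι, π, ⟨δ, h⟩, fun z => h.extVanish_cocone hX.hereditary (hp z), hp⟩

/-- In the injective coresolution `y ⟶ e ⟶ i` built from a projective-injective `q`, the conflation
splits because `y` is injective; so `y` is a summand of `e`, which receives a deflation from `q`. -/
lemma exists_deflation_of_inj {y : C} (hy : X.inj y) :
    ∃ (q : C) (p : q ⟶ y), X.projInj q ∧ X.IsDeflation p := by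
  obtain ⟨p, π, hp, p', ι, δ, h⟩ := hX.enough_projectives y
  obtain ⟨q, l, hq, i, g, δ', h'⟩ := hX.exists_inflation p hp
  obtain ⟨e, h₁, m, n, δ'', hq', -, -, hm, -, -⟩ := X.et4 h h'
  rw [hy _ (extPush X.E π δ')] at hm
  obtain ⟨f⟩ := hm.nonempty_iso_biprod
  refine ⟨q, h₁ ≫ f.hom ≫ biprod.fst, hq, IsDeflation.comp ⟨_, _, _, hq'⟩ ⟨i, biprod.inr ≫ f.inv, 0,
    X.realizes_of_iso (X.realizes_zero_symm i y) f.symm rfl (by simp)⟩⟩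

end IsZeroAuslander

/-! ### Bongartz completions and cotorsion pairs -/

section CotorsionPairs

variable {X : Extriangulation.{t, w, v, u} k C} (hX : X.IsZeroAuslander)
  {R : ObjectProperty C} (hR : X.IsRigid R) (hR_add : IsAdditiveSubcategory R)
  (hR_summands : IsClosedUnderSummands R)
include hX

include hR hR_add hR_summands in
lemma isLeftCotorsionPair_of_admitsMaximalBongartzCompletion
    (h : X.AdmitsMaximalBongartzCompletion R) : X.IsLeftCotorsionPair R (X.rightPerp R) where
  additive_left := hR_add
  additive_right := IsHereditary.isAdditiveSubcategory_rightPerp hX.hereditary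
  summands_left := hR_summands
  summands_right := IsHereditary.isClosedUnderSummands_rightPerp hX.hereditary
  ct2 := fun f ha _ => ⟨_, 𝟙 _, f, ha, hR.le_rightPerp _ ha, Category.id_comp f⟩
  ct3l := fun x => by
    obtain ⟨e, i, f, g, ⟨ε, hε⟩, he, hi⟩ := hX.exists_injective_coresolution x
    obtain ⟨r', p, -, hp, hp'⟩ := h i hi
    -- The cone must lie in `R`, but `r'` may have projective-injective summands; replacing `p^* ε`
    -- by `δ` removes them.
    obtain ⟨r, q, δ, hr, hδ⟩ := exists_pull_of_additiveClosure hR_add hp (extPull X.E p ε)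
    obtain ⟨b, j, l, hb⟩ := X.exists_realizes δ
    refine ⟨b, r, j, l, ⟨δ, hb⟩, ⟨(IsHereditary.rightPerp_iff hX.hereditary).2 fun s hs ξ => ?_,
      fun v hv φ => hb.exists_extension φ ((IsHereditary.rightPerp_iff hX.hereditary).1 hv r hr _)⟩, hr⟩
    -- A class in `𝔼(s, b)` comes from `𝔼(s, x)` by rigidity, there it is a pullback of `ε` and
    -- hence of `δ`, and `j_* δ = 0`.
    obtain ⟨ξ, rfl⟩ := ((hX.hereditary j l ⟨δ, hb⟩ s).1 ξ).1 (hR.extVanish hX.hereditary hs hr _)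
    obtain ⟨m, rfl⟩ := hε.exists_pull ξ (he _ _)
    obtain ⟨m, rfl⟩ := hp' s (le_additiveClosure _ _ (Or.inl hs)) m
    rw [extPull_comp, ← hδ, ← extPull_extPush, ← extPull_extPush, hb.push_self, map_zero, map_zero]

include hR hR_add hR_summands in
lemma isRightCotorsionPair_of_admitsMinimalBongartzCompletion
    (h : X.AdmitsMinimalBongartzCompletion R) : X.IsRightCotorsionPair (X.leftPerp R) R where
  additive_left := IsHereditary.isAdditiveSubcategory_leftPerp hX.hereditary
  additive_right := hR_add
  summands_left := IsHereditary.isClosedUnderSummands_leftPerp hX.hereditary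
  summands_right := hR_summands
  ct2 := fun f _ hb => ⟨_, f, 𝟙 _, hR.le_leftPerp _ hb, hb, Category.comp_id f⟩
  ct3r := fun x => by
    obtain ⟨i, e, f, g, ⟨ε, hε⟩, hi, he⟩ := hX.exists_projective_resolution x
    obtain ⟨r', p, -, hp, hp'⟩ := h i hi
    obtain ⟨r, q, δ, hr, hδ⟩ := exists_push_of_additiveClosure hR_add hp (extPush X.E p ε)
    obtain ⟨b, j, l, hb⟩ := X.exists_realizes δ
    refine ⟨r, b, j, l, ⟨δ, hb⟩, ⟨(IsHereditary.leftPerp_iff hX.hereditary).2 fun s hs ξ => ?_,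
      fun v hv φ => hb.exists_lift φ ((IsHereditary.leftPerp_iff hX.hereditary).1 hv r hr _)⟩, hr⟩
    obtain ⟨ξ, rfl⟩ := hb.exists_pull_of_pull_eq_zero ξ (hR.extVanish hX.hereditary hr hs _)
    obtain ⟨m, rfl⟩ := hε.exists_push ξ (he _ _)
    obtain ⟨m, rfl⟩ := hp' s (le_additiveClosure _ _ (Or.inl hs)) m
    rw [extPush_comp, ← hδ, extPull_extPush, extPull_extPush, hb.pull_self, map_zero, map_zero]

lemma admitsMaximalBongartzCompletion_of_isLeftCotorsionPair
    (h : X.IsLeftCotorsionPair R (X.rightPerp R)) : X.AdmitsMaximalBongartzCompletion R := by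
  intro y hy
  obtain ⟨q, p, hq, hp⟩ := hX.exists_deflation_of_inj hy
  obtain ⟨x, i, ε, hε⟩ := id hp
  obtain ⟨b, r, j, l, ⟨δ, hδ⟩, ⟨hb, -⟩, hr⟩ := h.ct3l x
  -- Injectivity of `q` makes `δ` a pullback of `ε`; its map `g` supplies the second component of
  -- the approximation.
  obtain ⟨g, hg⟩ := hε.exists_pull δ (hq.2 _ _)
  refine ⟨q ⊞ r, biprod.desc p g, hp.desc g, additiveClosure_biprod
    (le_additiveClosure _ _ (Or.inr hq)) (le_additiveClosure _ _ (Or.inl hr)), fun s hs f => ?_⟩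
  have hsb : X.ExtVanish s b := additiveClosure_le (isAdditiveSubcategory_extVanish_left b)
    (sup_le (fun r hr => (IsHereditary.rightPerp_iff hX.hereditary).1 hb r hr) fun r hr => hr.1 b) s hs
  -- The obstruction `f^* ε` to lifting `f` through `p` dies in `𝔼(s, b)`, so it equals `(m ≫ g)^*
  -- ε`; subtracting `m ≫ g` removes it.
  obtain ⟨m, hm⟩ := hδ.exists_pull (extPull X.E f ε) (hsb _)
  obtain ⟨n, hn⟩ := hε.exists_lift (f - m ≫ g)
    (by rw [X.pull_sub, extPull_comp, hg, hm, sub_self])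
  exact ⟨biprod.lift n m, by simp [hn]⟩

lemma admitsMinimalBongartzCompletion_of_isRightCotorsionPair
    (h : X.IsRightCotorsionPair (X.leftPerp R) R) : X.AdmitsMinimalBongartzCompletion R := by
  intro y hy
  obtain ⟨q, i, hq, hi⟩ := hX.exists_inflation y hy
  obtain ⟨x, p, ε, hε⟩ := id hi
  obtain ⟨r, b, j, l, ⟨δ, hδ⟩, ⟨hb, -⟩, hr⟩ := h.ct3r x
  obtain ⟨g, hg⟩ := hε.exists_push δ (hq.1 _ _)
  refine ⟨q ⊞ r, biprod.lift i g, hi.lift g, additiveClosure_biprod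
    (le_additiveClosure _ _ (Or.inr hq)) (le_additiveClosure _ _ (Or.inl hr)), fun s hs f => ?_⟩
  have hbs : X.ExtVanish b s := additiveClosure_le
    (isAdditiveSubcategory_extVanish_right hX.hereditary b)
    (sup_le (fun r hr => (IsHereditary.leftPerp_iff hX.hereditary).1 hb r hr) fun r hr => hr.2 b) s hs
  obtain ⟨m, hm⟩ := hδ.exists_push (extPush X.E f ε) (hbs _)
  obtain ⟨n, hn⟩ := hε.exists_extension (f - g ≫ m)
    (by rw [X.push_sub, extPush_comp, hg, hm, sub_self])
  exact ⟨biprod.desc n m, by simp [hn]⟩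

end CotorsionPairs

/-! ## The closures `R^∨` and `R^∧` -/

section Closures

variable {X : Extriangulation.{t, w, v, u} k C} (hX : X.IsHereditary)
  {R : ObjectProperty C} (hR : X.IsRigid R) (hR_add : IsAdditiveSubcategory R)
  (hR_summands : IsClosedUnderSummands R)

/-- Objects `x` admitting a conflation `x ⟶ r ⟶ r'` with `r`, `r'` in `P`. -/
def twoTermCoresolved (X : Extriangulation.{t, w, v, u} k C) (P : ObjectProperty C) :
    ObjectProperty C :=
  fun x => ∃ (r r' : C) (f : x ⟶ r) (g : r ⟶ r'), X.IsConflation f g ∧ P r ∧ P r'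

/-- Objects `x` admitting a conflation `r' ⟶ r ⟶ x` with `r`, `r'` in `P`. -/
def twoTermResolved (X : Extriangulation.{t, w, v, u} k C) (P : ObjectProperty C) :
    ObjectProperty C :=
  fun x => ∃ (r r' : C) (f : r' ⟶ r) (g : r ⟶ x), X.IsConflation f g ∧ P r ∧ P r'

lemma le_twoTermCoresolved (hP : IsAdditiveSubcategory R) : R ≤ twoTermCoresolved X R := by
  intro x hx
  obtain ⟨n, hn, hRn⟩ := hP.zero_mem
  exact ⟨x ⊞ n, n, _, _, ⟨0, X.realizes_zero x n⟩, hP.biprod_mem hx hRn, hRn⟩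

lemma le_twoTermResolved (hP : IsAdditiveSubcategory R) : R ≤ twoTermResolved X R := by
  intro x hx
  obtain ⟨n, hn, hRn⟩ := hP.zero_mem
  exact ⟨n ⊞ x, n, _, _, ⟨0, X.realizes_zero n x⟩, hP.biprod_mem hRn hx, hRn⟩

include hX hR hR_add

lemma isExtensionClosed_of_isRigid {a b c : C} {x : a ⟶ b} {y : b ⟶ c} {δ : ExtModule X.E c a}
    (h : X.Realizes x y δ) (ha : R a) (hc : R c) : R b := by
  obtain ⟨e⟩ := h.nonempty_iso_biprod_of_extVanish (hR.extVanish hX hc ha)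
  exact hR_add.iso_closed ⟨e.symm⟩ (hR_add.biprod_mem ha hc)

/-- An isomorphism is an inflation with zero cone, so (ET4) composes it with `f`, and the new cone
is an extension of `r'` by zero. -/
lemma twoTermCoresolved_of_iso {a b : C} (e : a ≅ b) (h : twoTermCoresolved X R a) :
    twoTermCoresolved X R b := by
  obtain ⟨r, r', f, g, ⟨δ, hδ⟩, hr, hr'⟩ := h
  have he : X.Realizes e.inv (0 : a ⟶ (0 : C)) 0 :=
    X.realizes_of_iso (X.realizes_zero b 0)
      ⟨biprod.fst ≫ e.inv, e.hom ≫ biprod.inl, by ext; simp, by simp⟩ (by simp)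
      ((isZero_zero C).eq_of_tgt _ _)
  obtain ⟨c, l, m, n, δ', hc, -, -, hm, -⟩ := X.et4 he hδ
  obtain ⟨z, hz, hRz⟩ := hR_add.zero_mem
  exact ⟨r, c, _, _, ⟨δ', hc⟩, hr, isExtensionClosed_of_isRigid hX hR hR_add hm
    (hR_add.iso_closed ⟨hz.iso (isZero_zero C)⟩ hRz) hr'⟩

lemma twoTermResolved_of_iso {a b : C} (e : a ≅ b) (h : twoTermResolved X R a) :
    twoTermResolved X R b := by
  obtain ⟨r, r', f, g, ⟨δ, hδ⟩, hr, hr'⟩ := h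
  have he : X.Realizes (0 : (0 : C) ⟶ a) e.hom 0 :=
    X.realizes_of_iso (X.realizes_zero 0 b)
      ⟨biprod.snd ≫ e.inv, e.hom ≫ biprod.inr, by ext; simp, by simp⟩ (by simp) (by simp)
  obtain ⟨c, l, m, n, δ', hc, -, -, hm, -⟩ := X.et4_op hδ he
  obtain ⟨z, hz, hRz⟩ := hR_add.zero_mem
  exact ⟨r, c, _, _, ⟨δ', hc⟩, hr, isExtensionClosed_of_isRigid hX hR hR_add hm hr'
    (hR_add.iso_closed ⟨hz.iso (isZero_zero C)⟩ hRz)⟩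

lemma isExtensionClosed_twoTermCoresolved : X.IsExtensionClosed (twoTermCoresolved X R) := by
  rintro a b c x y ⟨δ, h⟩ ⟨a₀, a₁, i, p, ⟨α, hα⟩, ha₀, ha₁⟩ ⟨c₀, c₁, j, q, ⟨γ, hγ⟩, hc₀, hc₁⟩
  obtain ⟨m, s, t, hm⟩ := X.exists_realizes
    (extPull X.E (biprod.fst : c ⊞ a₁ ⟶ c) δ + extPull X.E (biprod.snd : c ⊞ a₁ ⟶ a₁) α)
  obtain ⟨e, l, r, ⟨f⟩, ζ, hl⟩ := hm.exists_conflation_of_pull (X.realizes_zero c a₁)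
    (x := x) (y := y)
    (by rw [map_add, ← extPull_comp, ← extPull_comp, biprod.inl_fst, biprod.inl_snd,
      X.pull_zero_hom, extPull_id, add_zero]; exact h)
  obtain ⟨e', l', r', ⟨f'⟩, ζ', hl'⟩ := hm.exists_conflation_of_pull (X.realizes_zero_symm a₁ c)
    (x := i) (y := p)
    (by rw [map_add, ← extPull_comp, ← extPull_comp, biprod.inr_fst, biprod.inr_snd,
      X.pull_zero_hom, extPull_id, zero_add]; exact hα)
  -- So far `m` is an extension of `c` by `a₀` containing `b` with cone `a₁`. Lifting `γ` to `m`
  -- enlarges it to `n`, an extension of `c₀` by `a₀`; the cone of `b ⟶ n` is then an extension of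
  -- `c₁` by `a₁`.
  obtain ⟨η, rfl⟩ := (hX l' r' ⟨ζ', hl'⟩ c₁).2 γ
  obtain ⟨n, u, v, hn⟩ := X.exists_realizes η
  obtain ⟨d, _, _, ⟨g⟩, θ, hd⟩ := hn.exists_conflation_of_push hl' hγ
  have hRn : R n := isExtensionClosed_of_isRigid hX hR hR_add hd
    (hR_add.iso_closed ⟨f'.symm⟩ ha₀) (hR_add.iso_closed ⟨g.symm⟩ hc₀)
  obtain ⟨d', _, _, _, ξ, hξ, -, -, hd', -⟩ := X.et4 hl hn
  exact twoTermCoresolved_of_iso hX hR hR_add f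
    ⟨n, d', _, _, ⟨ξ, hξ⟩, hRn, isExtensionClosed_of_isRigid hX hR hR_add hd' ha₁ hc₁⟩

lemma isExtensionClosed_twoTermResolved : X.IsExtensionClosed (twoTermResolved X R) := by
  rintro a b c x y ⟨δ, h⟩ ⟨a₀, a₁, i, p, ⟨α, hα⟩, ha₀, ha₁⟩ ⟨c₀, c₁, j, q, ⟨γ, hγ⟩, hc₀, hc₁⟩
  obtain ⟨m, s, t, hm⟩ := X.exists_realizes
    (extPush X.E (biprod.inl : a ⟶ a ⊞ c₁) δ + extPush X.E (biprod.inr : c₁ ⟶ a ⊞ c₁) γ)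
  obtain ⟨e, l, r, ⟨f⟩, ζ, hl⟩ := hm.exists_conflation_of_push (X.realizes_zero_symm c₁ a)
    (x := x) (y := y)
    (by rw [map_add, ← extPush_comp, ← extPush_comp, biprod.inl_fst, biprod.inr_fst,
      X.push_zero_hom, extPush_id, add_zero]; exact h)
  obtain ⟨e', l', r', ⟨f'⟩, ζ', hl'⟩ := hm.exists_conflation_of_push (X.realizes_zero a c₁)
    (x := j) (y := q)
    (by rw [map_add, ← extPush_comp, ← extPush_comp, biprod.inl_snd, biprod.inr_snd,
      X.push_zero_hom, extPush_id, zero_add]; exact hγ)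
  obtain ⟨η, rfl⟩ := hX.pull_surjective hl' a₁ α
  obtain ⟨n, u, v, hn⟩ := X.exists_realizes η
  obtain ⟨d, _, _, ⟨g⟩, θ, hd⟩ := hn.exists_conflation_of_pull hl' hα
  have hRn : R n := isExtensionClosed_of_isRigid hX hR hR_add hd
    (hR_add.iso_closed ⟨g.symm⟩ ha₀) (hR_add.iso_closed ⟨f'.symm⟩ hc₀)
  obtain ⟨d', _, _, _, ξ, hξ, -, -, hd', -⟩ := X.et4_op hn hl
  exact twoTermResolved_of_iso hX hR hR_add f
    ⟨n, d', _, _, ⟨ξ, hξ⟩, hRn, isExtensionClosed_of_isRigid hX hR hR_add hd' ha₁ hc₁⟩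

include hR_summands

lemma isClosedUnderCocones_twoTermCoresolved :
    X.IsClosedUnderCocones (twoTermCoresolved X R) := by
  rintro a b c x y ⟨δ, h⟩ ⟨b₀, b₁, i, p, ⟨β, hβ⟩, hb₀, hb₁⟩ ⟨c₀, c₁, j, q, ⟨γ, hγ⟩, hc₀, hc₁⟩
  -- The cone `e` of `a ⟶ b₀` has a conflation `c ⟶ e ⟶ b₁`. Schanuel against `c ⟶ c₀ ⟶ c₁` makes
  -- `e` a summand of `c₀ ⊞ b₁`.
  obtain ⟨e, _, _, _, ξ, he, -, -, hs, -⟩ := X.et4 h hβ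
  exact ⟨b₀, e, _, _, ⟨ξ, he⟩, hb₀, hR_summands
    ((hs.schanuel hγ (he.extVanish_cone hX (hR.extVanish hX hc₁ hb₀))
      (hR.extVanish hX hb₁ hc₀)).map Iso.symm) (hR_add.biprod_mem hc₀ hb₁)⟩

lemma isClosedUnderCones_twoTermResolved : X.IsClosedUnderCones (twoTermResolved X R) := by
  rintro a b c x y ⟨δ, h⟩ ⟨a₀, a₁, i, p, ⟨α, hα⟩, ha₀, ha₁⟩ ⟨b₀, b₁, j, q, ⟨β, hβ⟩, hb₀, hb₁⟩
  obtain ⟨e, _, _, _, ξ, he, -, -, hs, -⟩ := X.et4_op hβ h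
  exact ⟨b₀, e, _, _, ⟨ξ, he⟩, hb₀, hR_summands
    ((hs.schanuel_op hα (he.extVanish_cocone hX (hR.extVanish hX hb₀ ha₁))
      (hR.extVanish hX ha₀ hb₁)).map Iso.symm) (hR_add.biprod_mem ha₀ hb₁)⟩

lemma isClosedUnderSummands_twoTermCoresolved :
    IsClosedUnderSummands (twoTermCoresolved X R) := by
  rintro x y z ⟨e⟩ ⟨r, r', i, p, ⟨δ, h⟩, hr, hr'⟩
  -- With `d` and `d₂` the cones of `x ⟶ r` and `y ⟶ r`, there are conflations `x ⟶ r ⟶ d` and `x ⟶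
  -- d₂ ⟶ r'`. Schanuel gives `r ⊞ r' ≅ d₂ ⊞ d`, so `d₂` is in `R` and the second conflation is the
  -- desired one.
  obtain ⟨d, _, _, _, ξ, hd, -, -, hd', -⟩ := X.et4 (realizes_of_biprod_iso e) h
  obtain ⟨d₂, _, _, _, ξ₂, hd₂, -, -, hd₂', -⟩ :=
    X.et4 (realizes_of_biprod_iso (e ≪≫ biprod.braiding x y)) h
  have hyr : X.ExtVanish y r :=
    (h.extVanish_cocone hX (hR.extVanish hX hr hr)).of_summand_left (e ≪≫ biprod.braiding x y)
  have hv : X.ExtVanish d d₂ :=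
    hd₂.extVanish_cone hX (hd'.extVanish_middle_left hyr (hR.extVanish hX hr' hr))
  exact ⟨d₂, r', _, _, ⟨_, hd₂'⟩,
    hR_summands (hd.schanuel hd₂' (hR.extVanish hX hr' hr) hv) (hR_add.biprod_mem hr hr'), hr'⟩

lemma isClosedUnderSummands_twoTermResolved :
    IsClosedUnderSummands (twoTermResolved X R) := by
  rintro x y z ⟨e⟩ ⟨r, r', i, p, ⟨δ, h⟩, hr, hr'⟩
  obtain ⟨d, _, _, _, ξ, hd, -, -, hd', -⟩ := X.et4_op h (realizes_of_biprod_iso e)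
  obtain ⟨d₂, _, _, _, ξ₂, hd₂, -, -, hd₂', -⟩ :=
    X.et4_op h (realizes_of_biprod_iso (e ≪≫ biprod.braiding x y))
  have hry : X.ExtVanish r y :=
    (h.extVanish_cone hX (hR.extVanish hX hr hr)).of_summand_right (e ≪≫ biprod.braiding x y)
  have hv : X.ExtVanish d d₂ :=
    hd.extVanish_cocone hX (hd₂'.extVanish_middle_right hX (hR.extVanish hX hr hr') hry)
  exact ⟨d, r', _, _, ⟨_, hd'⟩,
    hR_summands (hd₂.schanuel_op hd' (hR.extVanish hX hr hr') hv) (hR_add.biprod_mem hr hr'), hr'⟩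

lemma vee_le_twoTermCoresolved : X.vee R ≤ twoTermCoresolved X R := fun _ hx =>
  hx _ (le_twoTermCoresolved hR_add) (isExtensionClosed_twoTermCoresolved hX hR hR_add)
    (isClosedUnderCocones_twoTermCoresolved hX hR hR_add hR_summands)
    (isClosedUnderSummands_twoTermCoresolved hX hR hR_add hR_summands)

lemma wedge_le_twoTermResolved : X.wedge R ≤ twoTermResolved X R := fun _ hx =>
  hx _ (le_twoTermResolved hR_add) (isExtensionClosed_twoTermResolved hX hR hR_add)
    (isClosedUnderCones_twoTermResolved hX hR hR_add hR_summands)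
    (isClosedUnderSummands_twoTermResolved hX hR hR_add hR_summands)

lemma vee_le_leftPerp : X.vee R ≤ X.leftPerp R := fun x hx => by
  obtain ⟨r, r', i, p, ⟨δ, h⟩, hr, hr'⟩ :=
    vee_le_twoTermCoresolved hX hR hR_add hR_summands x hx
  exact hX.leftPerp_iff.2 fun s hs => h.extVanish_cocone hX (hR.extVanish hX hr hs)

lemma wedge_le_rightPerp : X.wedge R ≤ X.rightPerp R := fun x hx => by
  obtain ⟨r, r', i, p, ⟨δ, h⟩, hr, hr'⟩ :=
    wedge_le_twoTermResolved hX hR hR_add hR_summands x hx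
  exact hX.rightPerp_iff.2 fun s hs => h.extVanish_cone hX (hR.extVanish hX hs hr)

lemma vee_inf_rightPerp : X.vee R ⊓ X.rightPerp R = R := by
  refine le_antisymm ?_ (le_inf (fun x hx Q hQ _ _ _ => hQ x hx) hR.le_rightPerp)
  rintro x ⟨hx, hx'⟩
  obtain ⟨r, r', i, p, ⟨δ, h⟩, hr, hr'⟩ :=
    vee_le_twoTermCoresolved hX hR hR_add hR_summands x hx
  exact hR_summands (h.nonempty_iso_biprod_of_extVanish (hX.rightPerp_iff.1 hx' r' hr')) hr

lemma leftPerp_inf_wedge : X.leftPerp R ⊓ X.wedge R = R := by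
  refine le_antisymm ?_ (le_inf hR.le_leftPerp (fun x hx Q hQ _ _ _ => hQ x hx))
  rintro x ⟨hx', hx⟩
  obtain ⟨r, r', i, p, ⟨δ, h⟩, hr, hr'⟩ :=
    wedge_le_twoTermResolved hX hR hR_add hR_summands x hx
  obtain ⟨e⟩ := h.nonempty_iso_biprod_of_extVanish (hX.leftPerp_iff.1 hx' r' hr')
  exact hR_summands ⟨e ≪≫ biprod.braiding _ _⟩ hr

end Closures

/-! ### Formal closure properties of `R^∨` and `R^∧` -/

section ClosureProperties

variable (X : Extriangulation.{t, w, v, u} k C)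

lemma _root_.IsClosedUnderSummands.of_iso {P : ObjectProperty C} (hP : IsClosedUnderSummands P)
    {x y : C} (e : x ≅ y) (hx : P x) : P y :=
  hP ⟨e ≪≫ (⟨biprod.inl, biprod.fst, by simp, by ext; simp⟩ : y ≅ y ⊞ (0 : C))⟩ hx

lemma le_vee (P : ObjectProperty C) : P ≤ X.vee P := fun x hx _ hQ _ _ _ => hQ x hx

lemma le_wedge (P : ObjectProperty C) : P ≤ X.wedge P := fun x hx _ hQ _ _ _ => hQ x hx

lemma isExtensionClosed_vee (P : ObjectProperty C) : X.IsExtensionClosed (X.vee P) :=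
  fun x y h ha hc Q hQ h₁ h₂ h₃ => h₁ x y h (ha Q hQ h₁ h₂ h₃) (hc Q hQ h₁ h₂ h₃)

lemma isExtensionClosed_wedge (P : ObjectProperty C) : X.IsExtensionClosed (X.wedge P) :=
  fun x y h ha hc Q hQ h₁ h₂ h₃ => h₁ x y h (ha Q hQ h₁ h₂ h₃) (hc Q hQ h₁ h₂ h₃)

lemma isClosedUnderSummands_vee (P : ObjectProperty C) : IsClosedUnderSummands (X.vee P) :=
  fun e h Q hQ h₁ h₂ h₃ => h₃ e (h Q hQ h₁ h₂ h₃)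

lemma isClosedUnderSummands_wedge (P : ObjectProperty C) : IsClosedUnderSummands (X.wedge P) :=
  fun e h Q hQ h₁ h₂ h₃ => h₃ e (h Q hQ h₁ h₂ h₃)

variable {X} in
lemma IsExtensionClosed.isAdditiveSubcategory {P Q : ObjectProperty C}
    (hQ : X.IsExtensionClosed Q) (hQ' : IsClosedUnderSummands Q) (hP : IsAdditiveSubcategory P)
    (hPQ : P ≤ Q) : IsAdditiveSubcategory Q where
  iso_closed := fun ⟨e⟩ h => hQ'.of_iso e h
  zero_mem := hP.zero_mem.imp fun z hz => ⟨hz.1, hPQ z hz.2⟩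
  biprod_mem := fun hx hy => hQ _ _ ⟨_, X.realizes_zero _ _⟩ hx hy

end ClosureProperties

/-! ### Assembling the twin cotorsion pairs -/

section GCP

variable {X : Extriangulation.{t, w, v, u} k C} (hX : X.IsHereditary)
  {R : ObjectProperty C} (hR : X.IsRigid R) (hR_add : IsAdditiveSubcategory R)
  (hR_summands : IsClosedUnderSummands R)

include hR in
lemma IsGCTCP.of_cotorsionPairs (hl : X.IsLeftCotorsionPair R (X.rightPerp R))
    (hr : X.IsRightCotorsionPair (X.leftPerp R) R) :
    X.IsGCTCP R (X.rightPerp R) (X.leftPerp R) R where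
  left := hl
  right := hr
  le_left := hR.le_leftPerp
  le_right := hR.le_rightPerp
  concentric := by rw [inf_eq_left.2 hR.le_rightPerp, inf_eq_right.2 hR.le_leftPerp]

include hR_add in
lemma isLeftCotorsionPair_vee (h : X.IsLeftCotorsionPair R (X.rightPerp R)) :
    X.IsLeftCotorsionPair (X.vee R) (X.rightPerp R) where
  additive_left := IsExtensionClosed.isAdditiveSubcategory (X.isExtensionClosed_vee R)
    (X.isClosedUnderSummands_vee R) hR_add (X.le_vee R)
  additive_right := h.additive_right
  summands_left := X.isClosedUnderSummands_vee R
  summands_right := h.summands_right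
  ct2 := fun {a _} f ha hb => by
    -- The left `R^⊥`-approximation `m` of `a` is an extension of `r` in `R` by `a` in `R^∨`, so it
    -- lies in `R^∨ ∩ R^⊥`.
    obtain ⟨m, r, i, p, hi, ⟨hm, hm'⟩, hr⟩ := h.ct3l a
    obtain ⟨g, hg⟩ := hm' _ hb f
    exact ⟨m, i, g, X.isExtensionClosed_vee R i p hi ha (X.le_vee R _ hr), hm, hg⟩
  ct3l := fun x => by
    obtain ⟨m, r, i, p, hi, hm, hr⟩ := h.ct3l x
    exact ⟨m, r, i, p, hi, hm, X.le_vee R _ hr⟩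

include hR_add in
lemma isRightCotorsionPair_wedge (h : X.IsRightCotorsionPair (X.leftPerp R) R) :
    X.IsRightCotorsionPair (X.leftPerp R) (X.wedge R) where
  additive_left := h.additive_left
  additive_right := IsExtensionClosed.isAdditiveSubcategory (X.isExtensionClosed_wedge R)
    (X.isClosedUnderSummands_wedge R) hR_add (X.le_wedge R)
  summands_left := h.summands_left
  summands_right := X.isClosedUnderSummands_wedge R
  ct2 := fun {_ b} f ha hb => by
    obtain ⟨r, m, i, p, hi, ⟨hm, hm'⟩, hr⟩ := h.ct3r b
    obtain ⟨g, hg⟩ := hm' _ ha f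
    exact ⟨m, g, p, hm, X.isExtensionClosed_wedge R i p hi (X.le_wedge R _ hr) hb, hg⟩
  ct3r := fun x => by
    obtain ⟨r, m, i, p, hi, hm, hr⟩ := h.ct3r x
    exact ⟨r, m, i, p, hi, hm, X.le_wedge R _ hr⟩

include hX hR hR_add hR_summands in
lemma gcp_of_cotorsionPairs (hl : X.IsLeftCotorsionPair R (X.rightPerp R))
    (hr : X.IsRightCotorsionPair (X.leftPerp R) R) : X.GCP R where
  left := isLeftCotorsionPair_vee hR_add hl
  right := isRightCotorsionPair_wedge hR_add hr
  le_left := vee_le_leftPerp hX hR hR_add hR_summands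
  le_right := wedge_le_rightPerp hX hR hR_add hR_summands
  concentric := by
    rw [vee_inf_rightPerp hX hR hR_add hR_summands, leftPerp_inf_wedge hX hR hR_add hR_summands]

end GCP

end Extriangulation

theorem theorem6p8 {k : Type t} [Field k] {C : Type u} [Category.{v} C] [Preadditive C]
    [Linear k C] [HasZeroObject C] [HasBinaryBiproducts C]
    (X : Extriangulation.{t, w, v, u} k C) (hX : X.IsZeroAuslander)
    (R : ObjectProperty C) (hR : X.IsRigid R)
    (hR_add : IsAdditiveSubcategory R) (hR_summands : IsClosedUnderSummands R) :
    (X.AdmitsMaximalBongartzCompletion R ↔ X.IsLeftCotorsionPair R (X.rightPerp R)) ∧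
    (X.AdmitsMinimalBongartzCompletion R ↔ X.IsRightCotorsionPair (X.leftPerp R) R) ∧
    (X.AdmitsBongartzCompletions R ↔ X.IsGCTCP R (X.rightPerp R) (X.leftPerp R) R) ∧
    (X.AdmitsBongartzCompletions R → X.GCP R) := by
  have h₁ : X.AdmitsMaximalBongartzCompletion R ↔ X.IsLeftCotorsionPair R (X.rightPerp R) :=
    ⟨Extriangulation.isLeftCotorsionPair_of_admitsMaximalBongartzCompletion hX hR hR_add
      hR_summands, Extriangulation.admitsMaximalBongartzCompletion_of_isLeftCotorsionPair hX⟩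
  have h₂ : X.AdmitsMinimalBongartzCompletion R ↔ X.IsRightCotorsionPair (X.leftPerp R) R :=
    ⟨Extriangulation.isRightCotorsionPair_of_admitsMinimalBongartzCompletion hX hR hR_add
      hR_summands, Extriangulation.admitsMinimalBongartzCompletion_of_isRightCotorsionPair hX⟩
  exact ⟨h₁, h₂,
    ⟨fun h => Extriangulation.IsGCTCP.of_cotorsionPairs hR (h₁.1 h.1) (h₂.1 h.2),
      fun h => ⟨h₁.2 h.left, h₂.2 h.right⟩⟩,
    fun h => Extriangulation.gcp_of_cotorsionPairs hX.hereditary hR hR_add hR_summands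
      (h₁.1 h.1) (h₂.1 h.2)⟩
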